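/- Let $\alpha\in(0,2)$, $a>0$, and let $\varphi$ be a continuous, everywhere positive probability density on $\mathbb R^2$. On a probability space $(\Omega,\mathcal F,\mathsf P)$ let $(\Gamma_k)_{k\ge1}$, $(\xi_k)_{k\ge1}$, $(g_k)_{k\ge1}$ be three independent families of random variables, where $\Gamma_1<\Gamma_2<\dots$ are the arrival times of a Poisson process of unit intensity, the $\xi_k$ are independent random vectors in $\mathbb R^2$ with density $\varphi$, and the $g_k$ are independent centered Gaussian variables with $\mathsf E|g_k|^\alpha=1$. Put $C_\alpha=\Big(\frac{1-\alpha}{\Gamma(2-\alpha)\cos(\pi\alpha/2)}\Big)^{1/\alpha}$ for $\alpha\ne1$ and $C_1=\frac2\pi$. Let $M$ be the symmetric $\alpha$-stable random measure on $\mathbb R^2$, with Lebesgue control measure, given by its LePage series; that is, for a function $f$ on $\mathbb R^2$, $$\iint_{\mathbb R^2} f(x)\,M(dx)=C_\alpha\sum_{k=1}^\infty\Gamma_k^{-1/\alpha}\varphi(\xi_k)^{-1/\alpha}f(\xi_k)\,g_k,$$ at every $\omega\in\Omega$ at which the series (the limit of its partial sums in the order of $k$) converges. Let $\sigma:\mathbb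 R^2\times[0,\infty)\to\mathbb R$ be (S1) bounded and (S2) continuous. Define $$G(x,y,t)=\frac{1}{2\pi a}\,\mathbf 1_{|x-y|<at}\int_0^{t-|x-y|/a}\frac{\sigma(y,\tau)}{\sqrt{a^2(t-\tau)^2-|y-x|^2}}\,d\tau,\qquad U(x,t)=\iint_{\mathbb R^2}G(x,y,t)\,M(dy).$$ Let $\mathcal D(\mathbb R^2\times[0,\infty))$ be the class of compactly supported functions on $\mathbb R^2\times[0,\infty)$ that are infinitely differentiable up to the boundary $t=0$ (they need not vanish there). For $\theta$ in this class consider the identity $$\int_0^\infty\!\!\iint_{\mathbb R^2}U(x,t)\Big(\frac{\partial^2}{\partial t^2}\theta(x,t)-a^2\Delta\theta(x,t)\Big)\,dx\,dt=\int_0^\infty\Big(\iint_{\mathbb R^2}\theta(x,t)\sigma(x,t)\,M(dx)\Big)dt,\tag{1}$$ which is understood to include that, for the given $\omega$, the series defining $U(x,t)$ converges for almost all $(x,t)\in\mathbb R^2\times(0,\infty)$, the series for the inner integral on the right converges for almost all $t>0$, and both sides are absolutely convergent Lebesgue integrals. Then $U$ is a generalized solution of $\big(\frac{\partial^2}{\partial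 t^2}-a^2\Delta\big)U=\sigma\dot M$ with zero initial conditions, in the following sense. 1. If $\alpha\in(0,1)$, there is $\Omega_0\in\mathcal F$ with $\mathsf P(\Omega_0)=1$ such that (1) holds for all $\omega\in\Omega_0$ and all $\theta\in\mathcal D(\mathbb R^2\times[0,\infty))$. 2. If $\alpha\in[1,2)$, then for every $\theta\in\mathcal D(\mathbb R^2\times[0,\infty))$, (1) holds almost surely (the exceptional event may depend on $\theta$). -/

import Mathlib

open MeasureTheory ProbabilityTheory Filter Topology

namespace StableWave

noncomputable section

/-- The plane with its Euclidean norm and Lebesgue measure. -/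
abbrev Plane : Type := EuclideanSpace ℝ (Fin 2)

/-- The gaps `Γ 0, Γ 1 - Γ 0, Γ 2 - Γ 1, …` of a sequence of arrival times; the sequence is
indexed from zero, so that `Γ 0` is the first arrival. -/
def interarrival {Ω : Type*} (Γ : ℕ → Ω → ℝ) : ℕ → Ω → ℝ
  | 0 => Γ 0
  | k + 1 => fun ω => Γ (k + 1) ω - Γ k ω

/-- The data of a LePage series: a continuous positive probability density `φ` on the plane and
three independent families, namely the arrival times `Γ` of a Poisson process of unit intensity
(the gaps are independent exponential variables of mean one), independent random vectors `ξ k`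
with density `φ`, and independent centered Gaussian variables `g k` with `E |g k| ^ α = 1`. -/
structure IsLePageSystem {Ω : Type*} [MeasurableSpace Ω] (P : Measure Ω) (α : ℝ)
    (φ : Plane → ℝ) (Γ : ℕ → Ω → ℝ) (ξ : ℕ → Ω → Plane) (g : ℕ → Ω → ℝ) : Prop where
  continuous_density : Continuous φ
  density_pos : ∀ x, 0 < φ x
  lintegral_density : ∫⁻ x, ENNReal.ofReal (φ x) = 1
  measurable_arrival : ∀ k, Measurable (Γ k)
  measurable_position : ∀ k, Measurable (ξ k)
  measurable_gaussian : ∀ k, Measurable (g k)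
  indep_interarrival : iIndepFun (interarrival Γ) P
  law_interarrival : ∀ k, P.map (interarrival Γ k) = expMeasure 1
  indep_position : iIndepFun ξ P
  law_position : ∀ k, P.map (ξ k) = volume.withDensity (fun x => ENNReal.ofReal (φ x))
  indep_gaussian : iIndepFun g P
  law_gaussian : ∀ k, ∃ v : NNReal, P.map (g k) = gaussianReal 0 v
  moment_gaussian : ∀ k, ∫ ω, |g k ω| ^ α ∂P = 1
  /-- The next two fields together say that the three families are mutually independent. -/
  indep_arrival : IndepFun (fun ω k => Γ k ω) (fun ω => ((fun k => ξ k ω), (fun k => g k ω))) P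
  indep_position_gaussian : IndepFun (fun ω k => ξ k ω) (fun ω k => g k ω) P

/-- The constant `(∫₀^∞ u ^ (-α) sin u du) ^ (-1/α)` in closed form. With it, the variable
`stableIntegral … (Set.indicator A 1)` below has characteristic function
`exp (-λ(A) |u| ^ α)`, where `λ` is Lebesgue measure. -/
def stableConst (α : ℝ) : ℝ :=
  if α = 1 then 2 / Real.pi
  else ((1 - α) / (Real.Gamma (2 - α) * Real.cos (Real.pi * α / 2))) ^ (1 / α)

section LePage

variable {Ω : Type*} (α : ℝ) (φ : Plane → ℝ) (Γ : ℕ → Ω → ℝ) (ξ : ℕ → Ω → Plane) (g : ℕ → Ω → ℝ)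

/-- Partial sums of the LePage series of a function `f` at the outcome `ω`. -/
def lePagePartialSum (f : Plane → ℝ) (ω : Ω) (N : ℕ) : ℝ :=
  ∑ k ∈ Finset.range N, Γ k ω ^ (-1 / α) * φ (ξ k ω) ^ (-1 / α) * f (ξ k ω) * g k ω

/-- The LePage series of `f` converges at `ω`. -/
def LePageConverges (f : Plane → ℝ) (ω : Ω) : Prop :=
  ∃ l : ℝ, Tendsto (lePagePartialSum α φ Γ ξ g f ω) atTop (𝓝 l)

/-- The stochastic integral `∬ f(x) M(dx)` with respect to the symmetric stable random measure
`M(A) = C_α ∑ₖ Γₖ ^ (-1/α) φ(ξₖ) ^ (-1/α) 1_A(ξₖ) gₖ`, as the (ordered) sum of its LePage series.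
It is meaningful at those `ω` at which the series converges. -/
def stableIntegral (f : Plane → ℝ) (ω : Ω) : ℝ :=
  stableConst α * limUnder atTop (lePagePartialSum α φ Γ ξ g f ω)

end LePage

/-- The kernel `G(x, y, t)` in Poisson's formula for the planar wave equation of speed `a`.
(The integral diverges only for `y = x`, a null set of positions.) -/
def poissonKernel (a : ℝ) (σ : Plane → ℝ → ℝ) (x y : Plane) (t : ℝ) : ℝ :=
  if ‖x - y‖ < a * t then
    1 / (2 * Real.pi * a) *
      ∫ τ in (0 : ℝ)..(t - ‖x - y‖ / a), σ y τ / Real.sqrt (a ^ 2 * (t - τ) ^ 2 - ‖y - x‖ ^ 2)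
  else 0

/-- The candidate solution `U(x, t) = ∬ G(x, y, t) M(dy)`. -/
def candidate {Ω : Type*} (α : ℝ) (φ : Plane → ℝ) (Γ : ℕ → Ω → ℝ) (ξ : ℕ → Ω → Plane)
    (g : ℕ → Ω → ℝ) (a : ℝ) (σ : Plane → ℝ → ℝ) (x : Plane) (t : ℝ) (ω : Ω) : ℝ :=
  stableIntegral α φ Γ ξ g (fun y => poissonKernel a σ x y t) ω

/-- Compactly supported functions on `ℝ² × [0, ∞)` that are smooth up to the boundary `t = 0`
(where they need not vanish). Values at negative times are irrelevant. -/
structure IsTestFunction (θ : Plane → ℝ → ℝ) : Prop where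
  smooth : ContDiffOn ℝ ((⊤ : ℕ∞) : WithTop ℕ∞) (Function.uncurry θ) (Set.univ ×ˢ Set.Ici (0 : ℝ))
  compact_support : ∃ K : Set (Plane × ℝ), IsCompact K ∧
    ∀ x t, 0 ≤ t → (x, t) ∉ K → θ x t = 0

/-- The wave operator `∂²θ/∂t² - a² Δθ`, used at times `t > 0` only. -/
def waveOperator (a : ℝ) (θ : Plane → ℝ → ℝ) (x : Plane) (t : ℝ) : ℝ :=
  iteratedDeriv 2 (fun s => θ x s) t - a ^ 2 * Laplacian.laplacian (fun z => θ z t) x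

/-- The weak form of the wave equation `(∂²/∂t² - a² Δ) U = σ Ṁ`, tested against `θ` at the
outcome `ω`, together with the existence of everything that occurs in it: the stochastic integrals
exist for almost all `(x, t)`, respectively `t`, and the Lebesgue integrals exist. -/
structure WeakIdentity {Ω : Type*} (α : ℝ) (φ : Plane → ℝ) (Γ : ℕ → Ω → ℝ) (ξ : ℕ → Ω → Plane)
    (g : ℕ → Ω → ℝ) (a : ℝ) (σ : Plane → ℝ → ℝ) (θ : Plane → ℝ → ℝ) (ω : Ω) : Prop where
  candidate_defined : ∀ᵐ p : Plane × ℝ ∂(volume.restrict (Set.univ ×ˢ Set.Ioi (0 : ℝ))),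
    LePageConverges α φ Γ ξ g (fun y => poissonKernel a σ p.1 y p.2) ω
  integrable_left : IntegrableOn
    (fun p : Plane × ℝ => candidate α φ Γ ξ g a σ p.1 p.2 ω * waveOperator a θ p.1 p.2)
    (Set.univ ×ˢ Set.Ioi (0 : ℝ))
  source_defined : ∀ᵐ t ∂(volume.restrict (Set.Ioi (0 : ℝ))),
    LePageConverges α φ Γ ξ g (fun x => θ x t * σ x t) ω
  integrable_right : IntegrableOn
    (fun t : ℝ => stableIntegral α φ Γ ξ g (fun x => θ x t * σ x t) ω) (Set.Ioi (0 : ℝ))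
  identity :
    ∫ t in Set.Ioi (0 : ℝ), ∫ x : Plane, candidate α φ Γ ξ g a σ x t ω * waveOperator a θ x t =
      ∫ t in Set.Ioi (0 : ℝ), stableIntegral α φ Γ ξ g (fun x => θ x t * σ x t) ω

end

end StableWave

/-! The equation is linear, and the LePage series presents `M` as a weighted sum of point masses at
the positions `ξ k`. Hence (1) is a sum of deterministic identities, one for each point mass: the
kernel G(·, y, ·), tested against the wave operator of θ, gives ∫ θ(y, τ) σ(y, τ) dτ
(`integral_poissonKernel_mul_waveOperator`). Probability enters only in exchanging the sum over k
with the integrals. The predicate `SumsAgainst` records that exchange, and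
`weakIdentity_of_sumsAgainst` then compares two numerical series with equal terms.

The deterministic identity rests on `waveKernel` being the forward fundamental solution
(`integral_waveKernel_mul_waveOperator`). The substitution |z| = a s sin β cancels its singularity
on the light cone and leaves the weight s sin β / (2π), as in the method of descent from three
dimensions. In the variables (s, β, φ), s sin β times the wave operator is an exact divergence
(`waveOperator_ray_eq`). The polar and azimuthal fluxes integrate to zero, and the time flux leaves
the value at the vertex. Nothing is asked of θ at t = 0, because a source at time τ > 0 is felt only
at times t > τ.

For the exchange, the time integral of the kernel is at most a constant times |z| ^ (-1/2), whose
square is still locally integrable in the plane. So G has first and second moments over bounded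
space-time regions, uniformly in y, and by finite speed of propagation only y in a bounded ball
contribute. The arrival times grow linearly, and the density φ cancels against the powers of φ in
the weights, which gives local summability of weights (`IsLePageSystem.ae_summable_weights`).

If α < 1, the weights themselves are locally summable and everything converges absolutely; the
exceptional event concerns the weights alone and therefore serves every θ. For any α < 2 the squared
weights are locally summable. Freezing `Γ` and `ξ` then leaves a Gaussian series with square
summable coefficients, treated by Kolmogorov's theorem and mean-square estimates
(`ae_sumsAgainst_gaussian`); the exceptional event now depends on the function integrated against,
hence on θ. -/

namespace StableWave

noncomputable section

/-! ### Moving frame of the circle and rays in the light cone. -/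

/-- The unit vector of the plane at angle `φ`. -/
def circ (φ : ℝ) : Plane :=
  Real.cos φ • EuclideanSpace.single 0 (1 : ℝ) + Real.sin φ • EuclideanSpace.single 1 (1 : ℝ)

/-- The derivative of `circ`, a unit vector orthogonal to it. -/
def circPerp (φ : ℝ) : Plane :=
  -Real.sin φ • EuclideanSpace.single 0 (1 : ℝ) + Real.cos φ • EuclideanSpace.single 1 (1 : ℝ)

lemma hasDerivAt_circ (φ : ℝ) : HasDerivAt circ (circPerp φ) φ :=
  ((Real.hasDerivAt_cos φ).smul_const _).add ((Real.hasDerivAt_sin φ).smul_const _)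

lemma hasDerivAt_circPerp (φ : ℝ) : HasDerivAt circPerp (-circ φ) φ := by
  have h := ((Real.hasDerivAt_sin φ).neg.smul_const (EuclideanSpace.single (0 : Fin 2) (1 : ℝ))).add
    ((Real.hasDerivAt_cos φ).smul_const (EuclideanSpace.single (1 : Fin 2) (1 : ℝ)))
  have e : -circ φ = -Real.cos φ • EuclideanSpace.single (0 : Fin 2) (1 : ℝ) +
      -Real.sin φ • EuclideanSpace.single (1 : Fin 2) (1 : ℝ) := by
    rw [circ]; module
  rw [e]
  exact h

@[fun_prop]
lemma continuous_circ : Continuous circ := by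
  unfold circ; fun_prop

@[fun_prop]
lemma continuous_circPerp : Continuous circPerp := by
  unfold circPerp; fun_prop

lemma norm_circ (φ : ℝ) : ‖circ φ‖ = 1 := by
  have : ‖circ φ‖ ^ 2 = 1 := by
    rw [EuclideanSpace.norm_sq_eq]
    simp [circ, Fin.sum_univ_two]
  nlinarith [norm_nonneg (circ φ)]

lemma circ_neg_pi : circ (-Real.pi) = circ Real.pi := by simp [circ]

lemma circPerp_neg_pi : circPerp (-Real.pi) = circPerp Real.pi := by simp [circPerp]

/-- The point of space-time reached from `(y, τ)` after time `s` along the direction with polar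
angle `β` and azimuth `φ`. -/
def ray (a : ℝ) (y : Plane) (τ s β φ : ℝ) : Plane × ℝ :=
  (y + (a * s * Real.sin β) • circ φ, τ + s)

/-! ### The wave operator as a divergence in ray coordinates. -/

section Derivatives

variable {f : Plane × ℝ → ℝ}

lemma hasDerivAt_ray_time (a : ℝ) (y : Plane) (τ s β φ : ℝ) :
    HasDerivAt (fun s => ray a y τ s β φ) ((a * Real.sin β) • circ φ, 1) s := by
  refine HasDerivAt.prodMk ?_ ((hasDerivAt_id s).const_add τ)
  have h : HasDerivAt (fun s => a * s * Real.sin β) (a * Real.sin β) s := by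
    simpa using ((hasDerivAt_id s).const_mul a).mul_const (Real.sin β)
  exact (h.smul_const (circ φ)).const_add y

lemma hasDerivAt_ray_polar (a : ℝ) (y : Plane) (τ s β φ : ℝ) :
    HasDerivAt (fun β => ray a y τ s β φ) ((a * s * Real.cos β) • circ φ, 0) β := by
  refine HasDerivAt.prodMk ?_ (hasDerivAt_const _ _)
  exact (((Real.hasDerivAt_sin β).const_mul (a * s)).smul_const (circ φ)).const_add y

lemma hasDerivAt_ray_azimuth (a : ℝ) (y : Plane) (τ s β φ : ℝ) :
    HasDerivAt (fun φ => ray a y τ s β φ) ((a * s * Real.sin β) • circPerp φ, 0) φ := by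
  refine HasDerivAt.prodMk ?_ (hasDerivAt_const _ _)
  exact ((hasDerivAt_circ φ).const_smul (a * s * Real.sin β)).const_add y

lemma continuous_ray (a : ℝ) (y : Plane) (τ : ℝ) :
    Continuous fun p : ℝ × ℝ × ℝ => ray a y τ p.1 p.2.1 p.2.2 := by
  unfold ray; fun_prop

/-- The direction `w` moves together with the base point `c`, as it does in the fluxes below. -/
lemma hasDerivAt_fderiv_comp (hf : ContDiff ℝ 2 f) {c : ℝ → Plane × ℝ} {w : ℝ → Plane × ℝ}
    {c' w' : Plane × ℝ} {x : ℝ} (hc : HasDerivAt c c' x) (hw : HasDerivAt w w' x) :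
    HasDerivAt (fun s => fderiv ℝ f (c s) (w s))
      (fderiv ℝ (fderiv ℝ f) (c x) c' (w x) + fderiv ℝ f (c x) w') x := by
  have h1 : DifferentiableAt ℝ (fderiv ℝ f) (c x) :=
    ((hf.fderiv_right (m := 1) (by norm_num)).differentiable (by norm_num)).differentiableAt
  exact (h1.hasFDerivAt.comp_hasDerivAt x hc).clm_apply hw

lemma fderiv_fderiv_comm (hf : ContDiff ℝ 2 f) (p u v : Plane × ℝ) :
    fderiv ℝ (fderiv ℝ f) p u v = fderiv ℝ (fderiv ℝ f) p v u :=
  (hf.contDiffAt.isSymmSndFDerivAt (by simp)) u v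

lemma fderiv_slice_time (hf : ContDiff ℝ 2 f) (x : Plane) (t : ℝ) :
    iteratedDeriv 2 (fun s => f (x, s)) t = fderiv ℝ (fderiv ℝ f) (x, t) (0, 1) (0, 1) := by
  have hc : ∀ s : ℝ, HasDerivAt (fun s : ℝ => ((x, s) : Plane × ℝ)) (0, 1) s := fun s =>
    (hasDerivAt_const s x).prodMk (hasDerivAt_id s)
  have h1 : deriv (fun s => f (x, s)) = fun s => fderiv ℝ f (x, s) (0, 1) := by
    funext s
    have := ((hf.differentiable (by norm_num)).differentiableAt (x := (x, s))).hasFDerivAt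
    exact (this.comp_hasDerivAt s (hc s)).deriv
  rw [iteratedDeriv_succ, iteratedDeriv_one, h1]
  have := hasDerivAt_fderiv_comp hf (hc t) (hasDerivAt_const t ((0, 1) : Plane × ℝ))
  simpa using this.deriv

lemma laplacian_slice_space (hf : ContDiff ℝ 2 f) (x : Plane) (t : ℝ) :
    Laplacian.laplacian (fun z => f (z, t)) x =
      ∑ i : Fin 2, fderiv ℝ (fderiv ℝ f) (x, t)
        (EuclideanSpace.single i 1, 0) (EuclideanSpace.single i 1, 0) := by
  have hc : ∀ z : Plane, HasFDerivAt (fun z : Plane => ((z, t) : Plane × ℝ))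
      (ContinuousLinearMap.inl ℝ Plane ℝ) z := fun z => hasFDerivAt_prodMk_left z t
  have h1 : fderiv ℝ (fun z => f (z, t)) =
      fun z => (fderiv ℝ f (z, t)).comp (ContinuousLinearMap.inl ℝ Plane ℝ) := by
    funext z
    have := ((hf.differentiable (by norm_num)).differentiableAt (x := (z, t))).hasFDerivAt
    exact (this.comp z (hc z)).fderiv
  have h2 : DifferentiableAt ℝ (fderiv ℝ f) (x, t) :=
    ((hf.fderiv_right (m := 1) (by norm_num)).differentiable (by norm_num)).differentiableAt
  rw [InnerProductSpace.laplacian_eq_iteratedFDeriv_orthonormalBasis _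
    (EuclideanSpace.basisFun (Fin 2) ℝ)]
  refine Finset.sum_congr rfl fun i _ => ?_
  rw [iteratedFDeriv_two_apply, h1]
  have h3 := (h2.hasFDerivAt.comp x (hc x)).clm_comp
    (hasFDerivAt_const (ContinuousLinearMap.inl ℝ Plane ℝ) x)
  have h4 := h3.fderiv
  simp only [Function.comp_def] at h4
  rw [h4]
  simp

lemma waveOperator_eq (hf : ContDiff ℝ 2 f) (a : ℝ) (x : Plane) (t : ℝ) :
    waveOperator a (fun x t => f (x, t)) x t =
      fderiv ℝ (fderiv ℝ f) (x, t) (0, 1) (0, 1) - a ^ 2 * ∑ i : Fin 2,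
        fderiv ℝ (fderiv ℝ f) (x, t) (EuclideanSpace.single i 1, 0)
          (EuclideanSpace.single i 1, 0) := by
  rw [waveOperator, fderiv_slice_time hf, laplacian_slice_space hf]

lemma continuous_waveOperator (hf : ContDiff ℝ 2 f) (a : ℝ) :
    Continuous fun p : Plane × ℝ => waveOperator a (fun x t => f (x, t)) p.1 p.2 := by
  have h : Continuous (fderiv ℝ (fderiv ℝ f)) :=
    (hf.fderiv_right (m := 1) (by norm_num)).continuous_fderiv (by norm_num)
  simp_rw [waveOperator_eq hf]
  fun_prop

/-- The trace of a form does not depend on the orthonormal basis; this moves the Laplacian to the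
radial and tangential frame. -/
lemma sum_bilinear_circ (B : Plane × ℝ →L[ℝ] Plane × ℝ →L[ℝ] ℝ) (hB : ∀ u v, B u v = B v u)
    (φ : ℝ) :
    ∑ i : Fin 2, B (EuclideanSpace.single i 1, 0) (EuclideanSpace.single i 1, 0) =
      B (circ φ, 0) (circ φ, 0) + B (circPerp φ, 0) (circPerp φ, 0) := by
  have h1 : ((circ φ, 0) : Plane × ℝ) = Real.cos φ • (EuclideanSpace.single 0 1, 0) +
      Real.sin φ • (EuclideanSpace.single 1 1, 0) := by simp [circ]
  have h2 : ((circPerp φ, 0) : Plane × ℝ) = (-Real.sin φ) • (EuclideanSpace.single 0 1, 0) +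
      Real.cos φ • (EuclideanSpace.single 1 1, 0) := by simp [circPerp]
  rw [h1, h2, Fin.sum_univ_two]
  simp only [map_add, map_smul, add_apply, smul_apply, smul_eq_mul]
  have := Real.sin_sq_add_cos_sq φ
  rw [hB (EuclideanSpace.single 1 1, 0) (EuclideanSpace.single 0 1, 0)]
  linear_combination (-(B (EuclideanSpace.single 0 1, 0)) (EuclideanSpace.single 0 1, 0)
    - (B (EuclideanSpace.single 1 1, 0)) (EuclideanSpace.single 1 1, 0)) * this

/-- Time component of the divergence form of the wave operator in spherical coordinates. -/
def timeFlux (f : Plane × ℝ → ℝ) (a : ℝ) (y : Plane) (τ s β φ : ℝ) : ℝ :=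
  Real.sin β * (fderiv ℝ f (ray a y τ s β φ) (-(a * s * Real.sin β) • circ φ, s) -
    f (ray a y τ s β φ))

/-- Polar component of the divergence form of the wave operator in spherical coordinates. -/
def polarFlux (f : Plane × ℝ → ℝ) (a : ℝ) (y : Plane) (τ s β φ : ℝ) : ℝ :=
  -a * (Real.sin β * Real.cos β) * fderiv ℝ f (ray a y τ s β φ) (circ φ, 0)

/-- Azimuthal component of the divergence form of the wave operator in spherical coordinates. -/
def azimuthFlux (f : Plane × ℝ → ℝ) (a : ℝ) (y : Plane) (τ s β φ : ℝ) : ℝ :=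
  -a * fderiv ℝ f (ray a y τ s β φ) (circPerp φ, 0)

/-- The three derivatives are written out so that their continuity and the algebra of
`waveOperator_ray_eq` can be read off. -/
def timeFluxDeriv (f : Plane × ℝ → ℝ) (a : ℝ) (y : Plane) (τ s β φ : ℝ) : ℝ :=
  Real.sin β * (fderiv ℝ (fderiv ℝ f) (ray a y τ s β φ) ((a * Real.sin β) • circ φ, 1)
      (-(a * s * Real.sin β) • circ φ, s) +
    fderiv ℝ f (ray a y τ s β φ) (-(a * Real.sin β) • circ φ, 1) -
    fderiv ℝ f (ray a y τ s β φ) ((a * Real.sin β) • circ φ, 1))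

def polarFluxDeriv (f : Plane × ℝ → ℝ) (a : ℝ) (y : Plane) (τ s β φ : ℝ) : ℝ :=
  -a * (Real.cos β * Real.cos β + Real.sin β * -Real.sin β) *
      fderiv ℝ f (ray a y τ s β φ) (circ φ, 0) +
    -a * (Real.sin β * Real.cos β) * (fderiv ℝ (fderiv ℝ f) (ray a y τ s β φ)
      ((a * s * Real.cos β) • circ φ, 0) (circ φ, 0))

def azimuthFluxDeriv (f : Plane × ℝ → ℝ) (a : ℝ) (y : Plane) (τ s β φ : ℝ) : ℝ :=
  -a * (fderiv ℝ (fderiv ℝ f) (ray a y τ s β φ) ((a * s * Real.sin β) • circPerp φ, 0)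
      (circPerp φ, 0) + fderiv ℝ f (ray a y τ s β φ) (-circ φ, 0))

lemma hasDerivAt_timeFlux (hf : ContDiff ℝ 2 f) (a : ℝ) (y : Plane) (τ s β φ : ℝ) :
    HasDerivAt (fun s => timeFlux f a y τ s β φ) (timeFluxDeriv f a y τ s β φ) s := by
  have hw : HasDerivAt (fun s : ℝ => ((-(a * s * Real.sin β) • circ φ, s) : Plane × ℝ))
      (-(a * Real.sin β) • circ φ, 1) s := by
    refine HasDerivAt.prodMk ?_ (hasDerivAt_id s)
    have h : HasDerivAt (fun s => -(a * s * Real.sin β)) (-(a * Real.sin β)) s := by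
      have h := (((hasDerivAt_id s).const_mul a).mul_const (Real.sin β)).neg
      rw [mul_one] at h
      exact h
    exact h.smul_const (circ φ)
  have hr := hasDerivAt_ray_time a y τ s β φ
  have hd := ((hf.differentiable (by norm_num)).differentiableAt
    (x := ray a y τ s β φ)).hasFDerivAt.comp_hasDerivAt s hr
  exact ((hasDerivAt_fderiv_comp hf hr hw).sub hd).const_mul _

lemma hasDerivAt_polarFlux (hf : ContDiff ℝ 2 f) (a : ℝ) (y : Plane) (τ s β φ : ℝ) :
    HasDerivAt (fun β => polarFlux f a y τ s β φ) (polarFluxDeriv f a y τ s β φ) β := by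
  have h := hasDerivAt_fderiv_comp hf (hasDerivAt_ray_polar a y τ s β φ)
    (hasDerivAt_const β ((circ φ, 0) : Plane × ℝ))
  rw [map_zero, add_zero] at h
  exact (((Real.hasDerivAt_sin β).mul (Real.hasDerivAt_cos β)).const_mul (-a)).mul h

lemma hasDerivAt_azimuthFlux (hf : ContDiff ℝ 2 f) (a : ℝ) (y : Plane) (τ s β φ : ℝ) :
    HasDerivAt (fun φ => azimuthFlux f a y τ s β φ) (azimuthFluxDeriv f a y τ s β φ) φ := by
  have h := hasDerivAt_fderiv_comp hf (hasDerivAt_ray_azimuth a y τ s β φ)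
    ((hasDerivAt_circPerp φ).prodMk (hasDerivAt_const φ (0 : ℝ)))
  exact h.const_mul (-a)

/-- The first-order terms cancel, the mixed space-time second derivatives cancel by symmetry, and
the radial second derivatives with factors sin² β and cos² β add up to a full one. -/
lemma waveOperator_ray_eq (hf : ContDiff ℝ 2 f) (a : ℝ) (y : Plane) (τ s β φ : ℝ) :
    s * Real.sin β * waveOperator a (fun x t => f (x, t)) (ray a y τ s β φ).1
        (ray a y τ s β φ).2 =
      timeFluxDeriv f a y τ s β φ + polarFluxDeriv f a y τ s β φ +
        azimuthFluxDeriv f a y τ s β φ := by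
  rw [waveOperator_eq hf, Prod.mk.eta, timeFluxDeriv, polarFluxDeriv, azimuthFluxDeriv,
    sum_bilinear_circ _ (fderiv_fderiv_comm hf _) φ]
  have hsymm := fderiv_fderiv_comm hf (ray a y τ s β φ)
  generalize fderiv ℝ (fderiv ℝ f) (ray a y τ s β φ) = B at *
  generalize fderiv ℝ f (ray a y τ s β φ) = D at *
  have e1 : ∀ (c t : ℝ), ((c • circ φ, t) : Plane × ℝ) = c • (circ φ, 0) + t • (0, 1) := by
    intro c t; simp
  have e2 : ∀ (c : ℝ), ((c • circPerp φ, 0) : Plane × ℝ) = c • (circPerp φ, 0) := by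
    intro c; simp
  have e3 : ((-circ φ, 0) : Plane × ℝ) = (-1 : ℝ) • (circ φ, 0) := by simp
  rw [e2, e3, e1, e1, e1, e1]
  simp only [map_add, map_smul, add_apply, smul_apply, smul_eq_mul]
  rw [hsymm (0, 1) (circ φ, 0)]
  have := Real.sin_sq_add_cos_sq β
  have h2 : Real.cos β ^ 2 = 1 - Real.sin β ^ 2 := by linarith
  ring_nf
  simp only [h2]
  ring

end Derivatives

/-! ### Integration of the divergence over the box of ray coordinates. -/

lemma intervalIntegral_swap_of_continuous {F : ℝ → ℝ → ℝ} (hF : Continuous (Function.uncurry F))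
    (a b c d : ℝ) :
    ∫ x in a..b, ∫ y in c..d, F x y = ∫ y in c..d, ∫ x in a..b, F x y := by
  apply MeasureTheory.intervalIntegral_intervalIntegral_swap
  refine (hF.continuousOn.integrableOn_compact
    (isCompact_uIcc (a := a) (b := b) |>.prod (isCompact_uIcc (a := c) (b := d)))).mono_set ?_
  exact Set.prod_mono Set.uIoc_subset_uIcc Set.uIoc_subset_uIcc

section Flux

variable {f : Plane × ℝ → ℝ}

lemma continuous_timeFluxDeriv (hf : ContDiff ℝ 2 f) (a : ℝ) (y : Plane) (τ : ℝ) :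
    Continuous fun p : ℝ × ℝ × ℝ => timeFluxDeriv f a y τ p.1 p.2.1 p.2.2 := by
  have h : Continuous (fderiv ℝ (fderiv ℝ f)) :=
    (hf.fderiv_right (m := 1) (by norm_num)).continuous_fderiv (by norm_num)
  have h1 : Continuous (fderiv ℝ f) := hf.continuous_fderiv (by norm_num)
  have hr := continuous_ray a y τ
  have h2 := h.comp hr
  have h3 := h1.comp hr
  simp only [Function.comp_def] at h2 h3
  unfold timeFluxDeriv
  fun_prop

lemma continuous_polarFluxDeriv (hf : ContDiff ℝ 2 f) (a : ℝ) (y : Plane) (τ : ℝ) :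
    Continuous fun p : ℝ × ℝ × ℝ => polarFluxDeriv f a y τ p.1 p.2.1 p.2.2 := by
  have h : Continuous (fderiv ℝ (fderiv ℝ f)) :=
    (hf.fderiv_right (m := 1) (by norm_num)).continuous_fderiv (by norm_num)
  have h1 : Continuous (fderiv ℝ f) := hf.continuous_fderiv (by norm_num)
  have hr := continuous_ray a y τ
  have h2 := h.comp hr
  have h3 := h1.comp hr
  simp only [Function.comp_def] at h2 h3
  unfold polarFluxDeriv
  fun_prop

lemma continuous_azimuthFluxDeriv (hf : ContDiff ℝ 2 f) (a : ℝ) (y : Plane) (τ : ℝ) :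
    Continuous fun p : ℝ × ℝ × ℝ => azimuthFluxDeriv f a y τ p.1 p.2.1 p.2.2 := by
  have h : Continuous (fderiv ℝ (fderiv ℝ f)) :=
    (hf.fderiv_right (m := 1) (by norm_num)).continuous_fderiv (by norm_num)
  have h1 : Continuous (fderiv ℝ f) := hf.continuous_fderiv (by norm_num)
  have hr := continuous_ray a y τ
  have h2 := h.comp hr
  have h3 := h1.comp hr
  simp only [Function.comp_def] at h2 h3
  unfold azimuthFluxDeriv
  fun_prop

/-- The azimuthal flux takes the same value at the angles -π and π. -/
lemma integral_azimuthFluxDeriv (hf : ContDiff ℝ 2 f) (a : ℝ) (y : Plane) (τ s β : ℝ) :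
    ∫ φ in -Real.pi..Real.pi, azimuthFluxDeriv f a y τ s β φ = 0 := by
  have k : Continuous fun φ : ℝ => (s, β, φ) := by fun_prop
  have hc := (continuous_azimuthFluxDeriv hf a y τ).comp k
  simp only [Function.comp_def] at hc
  rw [intervalIntegral.integral_eq_sub_of_hasDerivAt (f := fun φ => azimuthFlux f a y τ s β φ)
    (fun φ _ => hasDerivAt_azimuthFlux hf a y τ s β φ) (hc.intervalIntegrable _ _)]
  simp [azimuthFlux, ray, circ_neg_pi, circPerp_neg_pi]

/-- The factor sin β cos β kills the polar flux at both ends of the quarter turn. -/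
lemma integral_polarFluxDeriv (hf : ContDiff ℝ 2 f) (a : ℝ) (y : Plane) (τ s φ : ℝ) :
    ∫ β in 0..Real.pi / 2, polarFluxDeriv f a y τ s β φ = 0 := by
  have k : Continuous fun β : ℝ => (s, β, φ) := by fun_prop
  have hc := (continuous_polarFluxDeriv hf a y τ).comp k
  simp only [Function.comp_def] at hc
  rw [intervalIntegral.integral_eq_sub_of_hasDerivAt (f := fun β => polarFlux f a y τ s β φ)
    (fun β _ => hasDerivAt_polarFlux hf a y τ s β φ) (hc.intervalIntegrable _ _)]
  simp [polarFlux]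

/-- At the far end `f` vanishes with its derivative; at `s = 0` the direction in the flux is the
zero vector, so only the term -sin β f(y, τ) survives. -/
lemma integral_timeFluxDeriv (hf : ContDiff ℝ 2 f) (a : ℝ) (y : Plane) (τ S β φ : ℝ)
    (hS : f =ᶠ[𝓝 (ray a y τ S β φ)] 0) :
    ∫ s in 0..S, timeFluxDeriv f a y τ s β φ = Real.sin β * f (y, τ) := by
  have k : Continuous fun s : ℝ => (s, β, φ) := by fun_prop
  have hc := (continuous_timeFluxDeriv hf a y τ).comp k
  simp only [Function.comp_def] at hc
  rw [intervalIntegral.integral_eq_sub_of_hasDerivAt (f := fun s => timeFlux f a y τ s β φ)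
    (fun s _ => hasDerivAt_timeFlux hf a y τ s β φ) (hc.intervalIntegrable _ _)]
  have h1 : fderiv ℝ f (ray a y τ S β φ) = 0 := by
    rw [hS.fderiv_eq]; simp
  have h2 : f (ray a y τ S β φ) = 0 := hS.eq_of_nhds
  simp only [timeFlux, h1, h2]
  simp [ray]
  rw [show ((0, 0) : Plane × ℝ) = 0 from rfl, map_zero]
  ring

/-- The integral of a divergence over a box, with vanishing fluxes in two of the directions. -/
lemma integral_add_of_flux_eq_zero {T P A : ℝ → ℝ → ℝ → ℝ}
    (hT : Continuous fun p : ℝ × ℝ × ℝ => T p.1 p.2.1 p.2.2)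
    (hP : Continuous fun p : ℝ × ℝ × ℝ => P p.1 p.2.1 p.2.2)
    (hA : Continuous fun p : ℝ × ℝ × ℝ => A p.1 p.2.1 p.2.2) {S b c d : ℝ} {t : ℝ → ℝ}
    (iA : ∀ s β, ∫ φ in c..d, A s β φ = 0) (iP : ∀ s φ, ∫ β in 0..b, P s β φ = 0)
    (iT : ∀ β φ, ∫ s in 0..S, T s β φ = t β) :
    ∫ s in 0..S, ∫ β in 0..b, ∫ φ in c..d, (T s β φ + P s β φ + A s β φ) =
      ∫ β in 0..b, ∫ _φ in c..d, t β := by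
  have step1 : ∀ s β, ∫ φ in c..d, (T s β φ + P s β φ + A s β φ) =
      (∫ φ in c..d, T s β φ) + ∫ φ in c..d, P s β φ := by
    intro s β
    have k : Continuous fun φ : ℝ => (s, β, φ) := by fun_prop
    have kT : Continuous fun φ => T s β φ := hT.comp k
    have kP : Continuous fun φ => P s β φ := hP.comp k
    have kA : Continuous fun φ => A s β φ := hA.comp k
    have kTP : Continuous fun φ => T s β φ + P s β φ := kT.add kP
    rw [intervalIntegral.integral_add (kTP.intervalIntegrable _ _)
      (kA.intervalIntegrable _ _), iA, add_zero,
      intervalIntegral.integral_add (kT.intervalIntegrable _ _) (kP.intervalIntegrable _ _)]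
  have step2 : ∀ s, ∫ β in 0..b, ∫ φ in c..d, (T s β φ + P s β φ + A s β φ) =
      ∫ β in 0..b, ∫ φ in c..d, T s β φ := by
    intro s
    simp_rw [step1]
    have k : Continuous fun q : ℝ × ℝ => (s, q.1, q.2) := by fun_prop
    have kT : Continuous (Function.uncurry fun β φ => T s β φ) := hT.comp k
    have kP : Continuous (Function.uncurry fun β φ => P s β φ) := hP.comp k
    have i1 := intervalIntegral.continuous_parametric_intervalIntegral_of_continuous'
      (μ := volume) kT c d
    have i2 := intervalIntegral.continuous_parametric_intervalIntegral_of_continuous'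
      (μ := volume) kP c d
    -- The polar term vanishes only when β is integrated first, hence the swap.
    rw [intervalIntegral.integral_add (i1.intervalIntegrable _ _) (i2.intervalIntegrable _ _),
      intervalIntegral_swap_of_continuous kP]
    simp_rw [iP]
    simp
  simp_rw [step2]
  have c1 : Continuous (Function.uncurry fun s β => ∫ φ in c..d, T s β φ) := by
    refine intervalIntegral.continuous_parametric_intervalIntegral_of_continuous'
      (f := fun (q : ℝ × ℝ) φ => T q.1 q.2 φ) ?_ _ _
    exact hT.comp (by fun_prop : Continuous fun q : (ℝ × ℝ) × ℝ => (q.1.1, q.1.2, q.2))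
  rw [intervalIntegral_swap_of_continuous c1]
  refine intervalIntegral.integral_congr fun β _ => ?_
  have c2 : Continuous (Function.uncurry fun s φ => T s β φ) :=
    hT.comp (by fun_prop : Continuous fun q : ℝ × ℝ => (q.1, β, q.2))
  rw [intervalIntegral_swap_of_continuous c2]
  simp_rw [iT]

/-- The weighted integral of the wave operator along rays recovers the value at the vertex. -/
lemma integral_waveOperator_ray (hf : ContDiff ℝ 2 f) (a : ℝ) (y : Plane) (τ S : ℝ)
    (hS : ∀ x t, τ + S ≤ t → f =ᶠ[𝓝 (x, t)] 0) :
    ∫ s in 0..S, ∫ β in 0..Real.pi / 2, ∫ φ in -Real.pi..Real.pi,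
      s * Real.sin β * waveOperator a (fun x t => f (x, t)) (ray a y τ s β φ).1
        (ray a y τ s β φ).2 = 2 * Real.pi * f (y, τ) := by
  simp_rw [waveOperator_ray_eq hf]
  rw [integral_add_of_flux_eq_zero (continuous_timeFluxDeriv hf a y τ)
    (continuous_polarFluxDeriv hf a y τ) (continuous_azimuthFluxDeriv hf a y τ)
    (integral_azimuthFluxDeriv hf a y τ) (integral_polarFluxDeriv hf a y τ)
    (fun β φ => integral_timeFluxDeriv hf a y τ S β φ (hS _ _ le_rfl))]
  simp only [intervalIntegral.integral_const, smul_eq_mul, intervalIntegral.integral_const_mul,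
    intervalIntegral.integral_mul_const, integral_sin, Real.cos_zero, Real.cos_pi_div_two]
  ring

end Flux

/-! ### Polar coordinates and removal of the singularity of the kernel. -/

section PolarCoordinates

/-- The plane as a product, by its two Cartesian coordinates. -/
def planeEquiv : ℝ × ℝ ≃ᵐ Plane :=
  (MeasurableEquiv.finTwoArrow (α := ℝ)).symm.trans (MeasurableEquiv.toLp 2 (Fin 2 → ℝ))

lemma measurePreserving_planeEquiv : MeasurePreserving planeEquiv :=
  (EuclideanSpace.volume_preserving_symm_measurableEquiv_toLp (Fin 2)).symm.comp
    (volume_preserving_finTwoArrow ℝ).symm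

lemma planeEquiv_polarCoord_symm (p : ℝ × ℝ) :
    planeEquiv (polarCoord.symm p) = p.1 • circ p.2 := by
  ext i
  fin_cases i <;> simp [planeEquiv, circ, MeasurableEquiv.finTwoArrow]

lemma integral_plane_polar (F : Plane → ℝ) :
    ∫ z, F z = ∫ p in polarCoord.target, p.1 * F (p.1 • circ p.2) := by
  rw [← measurePreserving_planeEquiv.integral_comp planeEquiv.measurableEmbedding,
    ← integral_comp_polarCoord_symm]
  simp_rw [planeEquiv_polarCoord_symm, smul_eq_mul]

/-- The forward fundamental solution of the planar wave equation of speed `a`. -/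
def waveKernel (a : ℝ) (z : Plane) (s : ℝ) : ℝ :=
  if ‖z‖ < a * s then 1 / (2 * Real.pi * a) / Real.sqrt (a ^ 2 * s ^ 2 - ‖z‖ ^ 2) else 0

lemma image_sin_prod {c : ℝ} (hc : 0 < c) :
    (fun p : ℝ × ℝ => (c * Real.sin p.1, p.2)) ''
      (Set.Ioo 0 (Real.pi / 2) ×ˢ Set.Ioo (-Real.pi) Real.pi) =
      Set.Ioo 0 c ×ˢ Set.Ioo (-Real.pi) Real.pi := by
  ext ⟨r, φ⟩
  simp only [Set.mem_image, Set.mem_prod, Prod.mk.injEq, Prod.exists]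
  constructor
  · rintro ⟨β, ψ, ⟨hβ, hψ⟩, rfl, rfl⟩
    have h1 : 0 < Real.sin β := Real.sin_pos_of_pos_of_lt_pi hβ.1 (by linarith [hβ.2, Real.pi_pos])
    have h2 : Real.sin β < 1 := by
      rw [← Real.sin_pi_div_two]
      exact Real.sin_lt_sin_of_lt_of_le_pi_div_two (by linarith [hβ.1, Real.pi_pos]) le_rfl hβ.2
    exact ⟨⟨by positivity, by nlinarith⟩, hψ⟩
  · rintro ⟨hr, hφ⟩
    refine ⟨Real.arcsin (r / c), φ, ⟨⟨?_, ?_⟩, hφ⟩, ?_, rfl⟩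
    · exact Real.arcsin_pos.2 (div_pos hr.1 hc)
    · exact Real.arcsin_lt_pi_div_two.2 ((div_lt_one hc).2 hr.2)
    · rw [Real.sin_arcsin (by linarith [div_pos hr.1 hc]) ((div_lt_one hc).2 hr.2).le]
      field_simp

lemma injOn_sin_prod {c : ℝ} (hc : 0 < c) :
    Set.InjOn (fun p : ℝ × ℝ => (c * Real.sin p.1, p.2))
      (Set.Ioo 0 (Real.pi / 2) ×ˢ Set.Ioo (-Real.pi) Real.pi) := by
  rintro ⟨β, φ⟩ ⟨hβ, -⟩ ⟨β', φ'⟩ ⟨hβ', -⟩ h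
  simp only [Prod.mk.injEq] at h hβ hβ'
  have h1 : Real.sin β = Real.sin β' := mul_left_cancel₀ hc.ne' h.1
  have := Real.injOn_sin ⟨by linarith [hβ.1, Real.pi_pos], hβ.2.le⟩
    ⟨by linarith [hβ'.1, Real.pi_pos], hβ'.2.le⟩ h1
  rw [this, h.2]

lemma det_prodMap_smul_id (c : ℝ) :
    ((c • ContinuousLinearMap.id ℝ ℝ).prodMap (ContinuousLinearMap.id ℝ ℝ)).det = c := by
  rw [ContinuousLinearMap.det]
  have : (((c • ContinuousLinearMap.id ℝ ℝ).prodMap (ContinuousLinearMap.id ℝ ℝ) :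
      ℝ × ℝ →L[ℝ] ℝ × ℝ) : ℝ × ℝ →ₗ[ℝ] ℝ × ℝ) =
      (c • (LinearMap.id : ℝ →ₗ[ℝ] ℝ)).prodMap (LinearMap.id : ℝ →ₗ[ℝ] ℝ) := rfl
  rw [this, LinearMap.det_prodMap, LinearMap.det_smul]
  simp

lemma hasFDerivAt_sin_prod (c : ℝ) (p : ℝ × ℝ) :
    HasFDerivAt (fun p : ℝ × ℝ => (c * Real.sin p.1, p.2))
      (((c * Real.cos p.1) • ContinuousLinearMap.id ℝ ℝ).prodMap
        (ContinuousLinearMap.id ℝ ℝ)) p := by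
  have h : HasFDerivAt (fun x => c * Real.sin x)
      ((c * Real.cos p.1) • ContinuousLinearMap.id ℝ ℝ) p.1 := by
    refine (((Real.hasDerivAt_sin p.1).const_mul c).hasFDerivAt).congr_fderiv ?_
    ext; simp
  exact HasFDerivAt.prodMap p h (hasFDerivAt_id p.2)

/-- With r = a s sin β the square root in the kernel equals a s cos β, which is exactly the Jacobian
of the substitution. What remains of the kernel and the polar factor r is s sin β / (2π). -/
lemma integral_waveKernel_mul {a s : ℝ} (ha : 0 < a) (hs : 0 < s) {h : Plane → ℝ}
    (hh : Continuous h) :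
    ∫ z, waveKernel a z s * h z = (2 * Real.pi)⁻¹ * ∫ β in 0..Real.pi / 2,
      ∫ φ in -Real.pi..Real.pi, s * Real.sin β * h ((a * s * Real.sin β) • circ φ) := by
  have has : 0 < a * s := mul_pos ha hs
  have e1 : ∫ z, waveKernel a z s * h z =
      ∫ p in Set.Ioo 0 (a * s) ×ˢ Set.Ioo (-Real.pi) Real.pi,
        p.1 * (waveKernel a (p.1 • circ p.2) s * h (p.1 • circ p.2)) := by
    rw [integral_plane_polar]
    refine setIntegral_eq_of_subset_of_forall_sdiff_eq_zero
      polarCoord.open_target.measurableSet ?_ ?_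
    · exact Set.prod_mono (fun x hx => hx.1) le_rfl
    · rintro ⟨r, φ⟩ ⟨⟨hr, hφ⟩, hp⟩
      simp only [Set.mem_prod, not_and, Set.mem_Ioi, Set.mem_Ioo] at hr hp hφ
      have : ¬ r < a * s := fun hlt => hp ⟨hr, hlt⟩ hφ.1 hφ.2
      simp [waveKernel, norm_smul, norm_circ, abs_of_pos hr, this]
  rw [e1, ← image_sin_prod has, integral_image_eq_integral_abs_det_fderiv_smul volume
    (measurableSet_Ioo.prod measurableSet_Ioo)
    (fun p _ => (hasFDerivAt_sin_prod (a * s) p).hasFDerivWithinAt) (injOn_sin_prod has)]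
  have e2 : ∫ p in Set.Ioo 0 (Real.pi / 2) ×ˢ Set.Ioo (-Real.pi) Real.pi,
      (2 * Real.pi)⁻¹ * (s * Real.sin p.1 * h ((a * s * Real.sin p.1) • circ p.2)) =
      (2 * Real.pi)⁻¹ * ∫ β in 0..Real.pi / 2,
      ∫ φ in -Real.pi..Real.pi, s * Real.sin β * h ((a * s * Real.sin β) • circ φ) := by
    rw [integral_const_mul, Measure.volume_eq_prod, setIntegral_prod]
    · rw [intervalIntegral.integral_of_le (by positivity), integral_Ioc_eq_integral_Ioo]
      refine congrArg _ (setIntegral_congr_fun measurableSet_Ioo fun β _ => ?_)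
      rw [intervalIntegral.integral_of_le (by linarith [Real.pi_pos]),
        integral_Ioc_eq_integral_Ioo]
    · refine (ContinuousOn.integrableOn_compact (isCompact_Icc.prod isCompact_Icc) ?_).mono_set
        (Set.prod_mono Set.Ioo_subset_Icc_self Set.Ioo_subset_Icc_self)
      exact Continuous.continuousOn (by fun_prop)
  rw [← e2]
  refine setIntegral_congr_fun (measurableSet_Ioo.prod measurableSet_Ioo) ?_
  rintro ⟨β, φ⟩ ⟨hβ, -⟩
  simp only at hβ
  have hsin : 0 < Real.sin β :=
    Real.sin_pos_of_pos_of_lt_pi hβ.1 (by linarith [hβ.2, Real.pi_pos])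
  have hsin1 : Real.sin β < 1 := by
    rw [← Real.sin_pi_div_two]
    exact Real.sin_lt_sin_of_lt_of_le_pi_div_two (by linarith [hβ.1, Real.pi_pos]) le_rfl hβ.2
  have hcos : 0 < Real.cos β := Real.cos_pos_of_mem_Ioo ⟨by linarith [hβ.1, Real.pi_pos], hβ.2⟩
  have hn : ‖(a * s * Real.sin β) • circ φ‖ = a * s * Real.sin β := by
    rw [norm_smul, norm_circ, mul_one, Real.norm_of_nonneg (by positivity)]
  have hlt : a * s * Real.sin β < a * s := by nlinarith
  have hsq : a ^ 2 * s ^ 2 - (a * s * Real.sin β) ^ 2 = (a * s * Real.cos β) ^ 2 := by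
    have := Real.sin_sq_add_cos_sq β
    linear_combination (-(a ^ 2 * s ^ 2)) * this
  simp only [det_prodMap_smul_id, waveKernel, hn, hlt, if_true, hsq, smul_eq_mul]
  rw [Real.sqrt_sq (by positivity), abs_of_pos (by positivity)]
  field_simp

end PolarCoordinates

/-! ### The fundamental solution. -/

lemma waveOperator_eq_zero {f : Plane × ℝ → ℝ} (hf : ContDiff ℝ 2 f) (a : ℝ) {x : Plane} {t : ℝ}
    (h : f =ᶠ[𝓝 (x, t)] 0) : waveOperator a (fun x t => f (x, t)) x t = 0 := by
  rw [waveOperator_eq hf]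
  have h1 : fderiv ℝ f =ᶠ[𝓝 (x, t)] 0 := by
    have := h.fderiv (𝕜 := ℝ)
    refine this.trans (Eventually.of_forall fun p => ?_)
    simp
  rw [h1.fderiv_eq]
  simp

/-- `waveKernel` is a fundamental solution: it recovers a test function from its wave operator. -/
theorem integral_waveKernel_mul_waveOperator {f : Plane × ℝ → ℝ} (hf : ContDiff ℝ 2 f)
    (hc : HasCompactSupport f) {a : ℝ} (ha : 0 < a) (y : Plane) (τ : ℝ) :
    ∫ s in Set.Ioi (0 : ℝ), ∫ z, waveKernel a z s *
      waveOperator a (fun x t => f (x, t)) (y + z) (τ + s) = f (y, τ) := by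
  obtain ⟨T, hT⟩ : ∃ T : ℝ, ∀ p ∈ tsupport f, p.2 ≤ T := by
    obtain ⟨T, hT⟩ := (hc.isCompact.image continuous_snd).bddAbove
    exact ⟨T, fun p hp => hT ⟨p, hp, rfl⟩⟩
  -- The extra 1 puts times from `τ + S` on strictly beyond the support, so that `f` vanishes in a
  -- whole neighbourhood there.
  set S := max 0 (T + 1 - τ) with hSdef
  have hS0 : 0 ≤ S := le_max_left _ _
  have hvan : ∀ x t, τ + S ≤ t → f =ᶠ[𝓝 (x, t)] 0 := by
    intro x t ht
    refine notMem_tsupport_iff_eventuallyEq.1 fun hmem => ?_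
    have h1 := hT _ hmem
    have h2 := le_max_right 0 (T + 1 - τ)
    simp only at h1
    linarith
  have hcont := continuous_waveOperator hf a
  have hray := integral_waveOperator_ray hf a y τ S hvan
  have hzero : ∀ x t, τ + S ≤ t → waveOperator a (fun x t => f (x, t)) x t = 0 :=
    fun x t ht => waveOperator_eq_zero hf a (hvan x t ht)
  -- From here on only the continuity of `W`, its vanishing at late times and the ray identity
  -- matter.
  generalize waveOperator a (fun x t => f (x, t)) = W at *
  have e1 : ∀ s ∈ Set.Ioi (0 : ℝ), ∫ z, waveKernel a z s *
      W (y + z) (τ + s) = (2 * Real.pi)⁻¹ *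
        ∫ β in 0..Real.pi / 2, ∫ φ in -Real.pi..Real.pi,
          s * Real.sin β * W (ray a y τ s β φ).1
        (ray a y τ s β φ).2 := by
    intro s hs
    rw [integral_waveKernel_mul ha hs
      (h := fun z => W (y + z) (τ + s))
      (hcont.comp (by fun_prop : Continuous fun z : Plane => (y + z, τ + s)))]
    rfl
  rw [setIntegral_congr_fun measurableSet_Ioi e1, integral_const_mul]
  have e2 : ∫ s in Set.Ioi (0 : ℝ), ∫ β in 0..Real.pi / 2, ∫ φ in -Real.pi..Real.pi,
          s * Real.sin β * W (ray a y τ s β φ).1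
        (ray a y τ s β φ).2 = ∫ s in 0..S, ∫ β in 0..Real.pi / 2, ∫ φ in -Real.pi..Real.pi,
          s * Real.sin β * W (ray a y τ s β φ).1
        (ray a y τ s β φ).2 := by
    rw [intervalIntegral.integral_of_le hS0]
    refine setIntegral_eq_of_subset_of_forall_sdiff_eq_zero measurableSet_Ioi
      (fun s hs => hs.1) ?_
    rintro s ⟨hs, hs'⟩
    have hlt : S < s := by
      by_contra hle
      exact hs' ⟨hs, not_lt.1 hle⟩
    have : ∀ β φ, W (ray a y τ s β φ).1
        (ray a y τ s β φ).2 = 0 := fun β φ =>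
      hzero _ _ (by simp only [ray]; linarith)
    simp [this]
  rw [e2, hray]
  field_simp

/-- Locality allows a test function, smooth only for t ≥ 0, to be replaced near a point by a
globally smooth extension. -/
lemma waveOperator_congr {θ θ' : Plane → ℝ → ℝ} (a : ℝ) {x : Plane} {t : ℝ}
    (h : Function.uncurry θ =ᶠ[𝓝 (x, t)] Function.uncurry θ') :
    waveOperator a θ x t = waveOperator a θ' x t := by
  have h1 : (fun s => θ x s) =ᶠ[𝓝 t] fun s => θ' x s :=
    (Continuous.prodMk_right x).continuousAt.eventually h
  have h2 : (fun z => θ z t) =ᶠ[𝓝 x] fun z => θ' z t :=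
    (Continuous.prodMk_left t).continuousAt.eventually h
  rw [waveOperator, waveOperator, h1.iteratedDeriv_eq,
    (InnerProductSpace.laplacian_congr_nhds h2).eq_of_nhds]

/-! ### Test functions up to the boundary t = 0. -/

section TestFunctions

variable {θ : Plane → ℝ → ℝ}

lemma IsTestFunction.contDiffAt (hθ : IsTestFunction θ) {p : Plane × ℝ} (hp : 0 < p.2) :
    ContDiffAt ℝ ((⊤ : ℕ∞) : WithTop ℕ∞) (Function.uncurry θ) p :=
  hθ.smooth.contDiffAt (prod_mem_nhds univ_mem (Ici_mem_nhds hp))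

/-- Away from `t = 0` a test function agrees with a compactly supported smooth function on the
whole space-time. -/
lemma IsTestFunction.exists_extension (hθ : IsTestFunction θ) {τ : ℝ} (hτ : 0 < τ) :
    ∃ f : Plane × ℝ → ℝ, ContDiff ℝ 2 f ∧ HasCompactSupport f ∧
      ∀ p : Plane × ℝ, τ < p.2 → Function.uncurry θ =ᶠ[𝓝 p] f := by
  -- The cutoff is 0 for t ≤ τ/2 and 1 for t ≥ τ, which hides the uncontrolled values of `θ` at
  -- negative times.
  set χ : ℝ → ℝ := fun t => Real.smoothTransition ((t - τ / 2) / (τ / 2)) with hχ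
  have hχs : ContDiff ℝ 2 χ := Real.smoothTransition.contDiff.comp
    ((contDiff_id.sub contDiff_const).div_const _)
  have hχ0 : ∀ t, t ≤ τ / 2 → χ t = 0 := fun t ht =>
    Real.smoothTransition.zero_of_nonpos
      (div_nonpos_of_nonpos_of_nonneg (by linarith) (by linarith))
  have hχ1 : ∀ t, τ ≤ t → χ t = 1 := fun t ht =>
    Real.smoothTransition.one_of_one_le ((one_le_div (by linarith)).2 (by linarith))
  refine ⟨fun p => χ p.2 * Function.uncurry θ p, ?_, ?_, ?_⟩
  · rw [contDiff_iff_contDiffAt]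
    intro p
    rcases lt_or_ge 0 p.2 with hp | hp
    · exact (hχs.comp contDiff_snd).contDiffAt.mul (contDiffAt_infty.1 (hθ.contDiffAt hp) 2)
    · refine (contDiffAt_const (c := (0 : ℝ))).congr_of_eventuallyEq ?_
      have : ∀ᶠ q : Plane × ℝ in 𝓝 p, q.2 < τ / 2 :=
        continuous_snd.continuousAt.eventually (gt_mem_nhds (by linarith))
      filter_upwards [this] with q hq
      rw [hχ0 _ hq.le, zero_mul]
  · obtain ⟨K, hK, hKθ⟩ := hθ.compact_support
    refine HasCompactSupport.intro hK fun p hp => ?_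
    rcases lt_or_ge p.2 0 with h | h
    · simp only [hχ0 p.2 (by linarith), zero_mul]
    · simp only [Function.uncurry, hKθ p.1 p.2 h hp, mul_zero]
  · intro p hp
    have : ∀ᶠ q : Plane × ℝ in 𝓝 p, τ < q.2 :=
      continuous_snd.continuousAt.eventually (lt_mem_nhds hp)
    filter_upwards [this] with q hq
    rw [hχ1 _ hq.le, one_mul]

lemma IsTestFunction.continuousOn_waveOperator (hθ : IsTestFunction θ) (a : ℝ) :
    ContinuousOn (fun p : Plane × ℝ => waveOperator a θ p.1 p.2) (Set.univ ×ˢ Set.Ioi 0) := by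
  rintro p ⟨-, hp⟩
  have hp' : 0 < p.2 := hp
  obtain ⟨f, hf, -, hfθ⟩ := hθ.exists_extension (τ := p.2 / 2) (by linarith)
  refine ContinuousAt.continuousWithinAt ?_
  refine (continuous_waveOperator hf a).continuousAt.congr ?_
  have : ∀ᶠ q : Plane × ℝ in 𝓝 p, p.2 / 2 < q.2 :=
    continuous_snd.continuousAt.eventually (lt_mem_nhds (by linarith))
  filter_upwards [this] with q hq
  exact (waveOperator_congr (θ' := fun x t => f (x, t)) a (hfθ q hq)).symm

lemma norm_single_prod_zero (i : Fin 2) :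
    ‖((EuclideanSpace.single i (1 : ℝ), 0) : Plane × ℝ)‖ = 1 := by
  simp [Prod.norm_def]

/-- The second derivative within the closed half-space is continuous, hence bounded on the compact
part of the support there. At positive times it agrees with the full second derivative, so the bound
on the wave operator holds up to t = 0. -/
lemma IsTestFunction.exists_bound (hθ : IsTestFunction θ) (a : ℝ) :
    ∃ C R : ℝ, 0 ≤ C ∧ 0 < R ∧ (∀ x t, 0 ≤ t → |θ x t| ≤ C) ∧
      (∀ x t, 0 < t → |waveOperator a θ x t| ≤ C) ∧
      (∀ x t, 0 ≤ t → ¬ (‖x‖ ≤ R ∧ t < R) → θ x t = 0) ∧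
      (∀ x t, 0 < t → ¬ (‖x‖ ≤ R ∧ t < R) → waveOperator a θ x t = 0) := by
  obtain ⟨K, hK, hKθ⟩ := hθ.compact_support
  set S : Set (Plane × ℝ) := Set.univ ×ˢ Set.Ici 0 with hS
  have hSu : UniqueDiffOn ℝ S := uniqueDiffOn_univ.prod (uniqueDiffOn_Ici 0)
  have hSc : IsClosed S := isClosed_univ.prod isClosed_Ici
  have hKS : IsCompact (K ∩ S) := hK.inter_right hSc
  have hsm := hθ.smooth
  have c1 : ContinuousOn (fderivWithin ℝ (fderivWithin ℝ (Function.uncurry θ) S) S) S := by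
    have h1 := (contDiffOn_infty.1 hsm 2).fderivWithin (m := 1) hSu (by norm_num)
    exact h1.continuousOn_fderivWithin hSu le_rfl
  obtain ⟨C₁, hC₁⟩ := hKS.exists_bound_of_continuousOn
    (f := fderivWithin ℝ (fderivWithin ℝ (Function.uncurry θ) S) S) (c1.mono Set.inter_subset_right)
  obtain ⟨C₂, hC₂⟩ := hKS.exists_bound_of_continuousOn
    (hsm.continuousOn.mono Set.inter_subset_right)
  obtain ⟨R, hR⟩ := hK.isBounded.exists_norm_le
  have hzero : ∀ p : Plane × ℝ, 0 < p.2 → p ∉ K → waveOperator a θ p.1 p.2 = 0 := by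
    intro p hp hpK
    have : Function.uncurry θ =ᶠ[𝓝 p] Function.uncurry fun _ _ => (0 : ℝ) := by
      have h2 : ∀ᶠ q : Plane × ℝ in 𝓝 p, 0 < q.2 :=
        continuous_snd.continuousAt.eventually (lt_mem_nhds hp)
      filter_upwards [hK.isClosed.isOpen_compl.mem_nhds hpK, h2] with q hq hq2
      exact hKθ q.1 q.2 hq2.le hq
    rw [waveOperator_congr a this]
    exact waveOperator_eq_zero (f := fun _ => (0 : ℝ)) contDiff_const a
      (Eventually.of_forall fun _ => rfl)
  have hout : ∀ (x : Plane) (t : ℝ), 0 ≤ t → ¬ (‖x‖ ≤ |R| + 1 ∧ t < |R| + 1) → (x, t) ∉ K := by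
    intro x t ht h hmem
    have h1 := (hR _ hmem).trans (le_abs_self R)
    have h2 := norm_fst_le (x, t)
    have h3 := norm_snd_le (x, t)
    rw [Real.norm_of_nonneg ht] at h3
    exact h ⟨by simp only at h2; linarith, by linarith⟩
  -- The factor counts one second derivative in time and two in space, the latter weighted by `a ^
  -- 2`.
  refine ⟨max (|C₁| * (1 + 2 * a ^ 2)) |C₂|, |R| + 1, by positivity, by positivity, ?_, ?_, ?_, ?_⟩
  · intro x t ht
    by_cases h : (x, t) ∈ K
    · have := hC₂ (x, t) ⟨h, trivial, ht⟩
      exact (this.trans (le_abs_self _)).trans (le_max_right _ _)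
    · rw [hKθ x t ht h, abs_zero]; positivity
  · intro x t ht
    by_cases h : (x, t) ∈ K
    · refine le_trans ?_ (le_max_left _ _)
      obtain ⟨f, hf, -, hfθ⟩ := hθ.exists_extension (τ := t / 2) (by linarith)
      have hloc := hfθ (x, t) (by simp only; linarith)
      have hmem : S ∈ 𝓝 (x, t) := prod_mem_nhds univ_mem (Ici_mem_nhds ht)
      have hd : fderiv ℝ (fderiv ℝ f) (x, t) =
          fderivWithin ℝ (fderivWithin ℝ (Function.uncurry θ) S) S (x, t) := by
        rw [fderivWithin_of_mem_nhds hmem]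
        refine Filter.EventuallyEq.fderiv_eq ?_
        filter_upwards [hloc.eventuallyEq_nhds, eventually_mem_nhds_iff.2 hmem] with q hq hq'
        rw [fderivWithin_of_mem_nhds hq', hq.fderiv_eq]
      have hb := (hC₁ (x, t) ⟨h, trivial, ht.le⟩).trans (le_abs_self _)
      rw [← hd] at hb
      rw [waveOperator_congr (θ' := fun x t => f (x, t)) a hloc, waveOperator_eq hf,
        Fin.sum_univ_two]
      have key : ∀ u : Plane × ℝ, ‖u‖ = 1 → |fderiv ℝ (fderiv ℝ f) (x, t) u u| ≤ |C₁| := by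
        intro u hu
        have := (fderiv ℝ (fderiv ℝ f) (x, t)).le_opNorm₂ u u
        rw [hu, mul_one, mul_one] at this
        exact this.trans hb
      have k0 := abs_le.1 (key (0, 1) (by simp [Prod.norm_def]))
      have k1 := abs_le.1 (key _ (norm_single_prod_zero 0))
      have k2 := abs_le.1 (key _ (norm_single_prod_zero 1))
      have ha := sq_nonneg a
      rw [abs_le]
      constructor <;> nlinarith
    · rw [hzero (x, t) ht h, abs_zero]; positivity
  · intro x t ht h
    exact hKθ x t ht (hout x t ht h)
  · intro x t ht h
    exact hzero (x, t) ht (hout x t ht.le h)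

end TestFunctions

/-! ### Integrability of the wave kernel. -/

section KernelBounds

lemma measurable_waveKernel (a : ℝ) : Measurable fun p : Plane × ℝ => waveKernel a p.1 p.2 := by
  unfold waveKernel
  refine Measurable.ite (measurableSet_lt (by fun_prop) (by fun_prop)) ?_ measurable_const
  fun_prop

lemma waveKernel_nonneg {a : ℝ} (ha : 0 < a) (z : Plane) (s : ℝ) : 0 ≤ waveKernel a z s := by
  unfold waveKernel
  split_ifs <;> positivity

/-- The case distinction and the upper limit of integration are both encoded in the support of
`waveKernel`, since ‖x - y‖ < a (t - τ) means τ < t - ‖x - y‖ / a. -/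
lemma poissonKernel_eq {a : ℝ} (ha : 0 < a) (σ : Plane → ℝ → ℝ) (x y : Plane) (t : ℝ) :
    poissonKernel a σ x y t = ∫ τ in Set.Ioi (0 : ℝ), waveKernel a (x - y) (t - τ) * σ y τ := by
  have key : ∀ τ, ‖x - y‖ < a * (t - τ) ↔ τ < t - ‖x - y‖ / a := by
    intro τ
    rw [lt_sub_comm, div_lt_iff₀ ha, mul_comm]
  rw [poissonKernel]
  split_ifs with h
  · have hL : 0 < t - ‖x - y‖ / a := by
      rw [← key 0]; simpa using h
    rw [intervalIntegral.integral_of_le hL.le, integral_Ioc_eq_integral_Ioo,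
      ← integral_const_mul]
    symm
    refine (setIntegral_eq_of_subset_of_forall_sdiff_eq_zero measurableSet_Ioi
      Set.Ioo_subset_Ioi_self ?_).trans (setIntegral_congr_fun measurableSet_Ioo ?_)
    · rintro τ ⟨h1, h2⟩
      have : ¬ ‖x - y‖ < a * (t - τ) := fun h3 => h2 ⟨h1, (key τ).1 h3⟩
      simp [waveKernel, this]
    · rintro τ ⟨-, h2⟩
      have := (key τ).2 h2
      simp only [waveKernel, this, if_true, norm_sub_rev y x]
      ring
  · symm
    refine setIntegral_eq_zero_of_forall_eq_zero fun τ hτ => ?_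
    have hτ' : 0 < τ := hτ
    have : ¬ ‖x - y‖ < a * (t - τ) := by
      have := mul_pos ha hτ'
      linarith [not_lt.1 h, mul_sub a t τ]
    simp [waveKernel, this]

/-- Radial majorant, on the time interval `(0, T]`, of the time integral of `waveKernel`. -/
def waveBound (a T : ℝ) (z : Plane) : ℝ :=
  (1 / (2 * Real.pi * a) / Real.sqrt (2 * a) * (2 * Real.sqrt T)) *
    if ‖z‖ < a * T then ‖z‖ ^ (-(1 / 2) : ℝ) else 0

lemma waveBound_nonneg {a : ℝ} (ha : 0 < a) (T : ℝ) (z : Plane) : 0 ≤ waveBound a T z := by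
  unfold waveBound
  split_ifs <;> positivity

lemma measurable_waveBound (a T : ℝ) : Measurable (waveBound a T) := by
  unfold waveBound
  refine measurable_const.mul (Measurable.ite (measurableSet_lt (by fun_prop) (by fun_prop)) ?_
    measurable_const)
  fun_prop

lemma integral_rpow_sub (L : ℝ) :
    IntervalIntegrable (fun τ => (L - τ) ^ (-(1 / 2) : ℝ)) volume 0 L ∧
      ∫ τ in 0..L, (L - τ) ^ (-(1 / 2) : ℝ) = 2 * Real.sqrt L := by
  constructor
  · have h := (intervalIntegral.intervalIntegrable_rpow' (a := 0) (b := L) (r := -(1 / 2))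
      (by norm_num)).comp_sub_left L
    simpa using h.symm
  · rw [intervalIntegral.integral_comp_sub_left (fun x => x ^ (-(1 / 2) : ℝ)) L,
      integral_rpow (Or.inl (by norm_num)), Real.sqrt_eq_rpow]
    norm_num
    ring

/-- Put r = ‖z‖, s = t - τ and L = t - r / a. Then a²s² - r² = (as - r)(as + r), with as - r = a(L -
τ) and as + r ≥ 2r. So the kernel is at most a constant times r ^ (-1/2) (L - τ) ^ (-1/2), and the
last factor integrates to 2√L ≤ 2√T. -/
lemma lintegral_waveKernel_le {a T t : ℝ} (ha : 0 < a) (ht : t ≤ T) {z : Plane} (hz : z ≠ 0) :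
    ∫⁻ τ in Set.Ioi (0 : ℝ), ENNReal.ofReal (waveKernel a z (t - τ)) ≤
      ENNReal.ofReal (waveBound a T z) := by
  have hr : 0 < ‖z‖ := norm_pos_iff.2 hz
  have key : ∀ τ, ‖z‖ < a * (t - τ) ↔ τ < t - ‖z‖ / a := by
    intro τ
    rw [lt_sub_comm, div_lt_iff₀ ha, mul_comm]
  set L := t - ‖z‖ / a with hL
  rcases le_or_gt L 0 with h0 | h0
  · have : ∀ τ ∈ Set.Ioi (0 : ℝ), ENNReal.ofReal (waveKernel a z (t - τ)) = 0 := by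
      intro τ hτ
      have : ¬ ‖z‖ < a * (t - τ) := fun h => by
        have := (key τ).1 h
        have : 0 < τ := hτ
        linarith
      simp [waveKernel, this]
    rw [setLIntegral_congr_fun measurableSet_Ioi this]
    simp
  have hzT : ‖z‖ < a * T := by
    have := (key 0).2 h0
    nlinarith
  obtain ⟨hi, hval⟩ := integral_rpow_sub L
  set c := 1 / (2 * Real.pi * a) / Real.sqrt (2 * a) * ‖z‖ ^ (-(1 / 2) : ℝ) with hc
  have hc0 : 0 ≤ c := by positivity
  have hpt : ∀ τ ∈ Set.Ioi (0 : ℝ), ENNReal.ofReal (waveKernel a z (t - τ)) ≤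
      (Set.Ioo 0 L).indicator (fun τ => ENNReal.ofReal (c * (L - τ) ^ (-(1 / 2) : ℝ))) τ := by
    intro τ hτ
    by_cases hlt : τ < L
    · rw [Set.indicator_of_mem (show τ ∈ Set.Ioo 0 L from ⟨hτ, hlt⟩)]
      apply ENNReal.ofReal_le_ofReal
      have hk := (key τ).2 hlt
      rw [waveKernel, if_pos hk, hc]
      have hLτ : 0 < L - τ := by linarith
      have e1 : a * (t - τ) - ‖z‖ = a * (L - τ) := by rw [hL]; field_simp; ring
      have e2 : (2 * a) * ‖z‖ * (L - τ) ≤ a ^ 2 * (t - τ) ^ 2 - ‖z‖ ^ 2 := by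
        have : a ^ 2 * (t - τ) ^ 2 - ‖z‖ ^ 2 = (a * (t - τ) - ‖z‖) * (a * (t - τ) + ‖z‖) := by ring
        rw [this, e1]
        have : 2 * ‖z‖ ≤ a * (t - τ) + ‖z‖ := by linarith
        have h3 := mul_le_mul_of_nonneg_left this (mul_pos ha hLτ).le
        linarith
      have e3 := Real.sqrt_le_sqrt e2
      rw [Real.sqrt_mul (by positivity), Real.sqrt_mul (by positivity)] at e3
      have e4 : 0 < √(2 * a) * √‖z‖ * √(L - τ) := by positivity
      rw [Real.rpow_neg hr.le, Real.rpow_neg hLτ.le, ← Real.sqrt_eq_rpow, ← Real.sqrt_eq_rpow]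
      calc 1 / (2 * Real.pi * a) / √(a ^ 2 * (t - τ) ^ 2 - ‖z‖ ^ 2)
          ≤ 1 / (2 * Real.pi * a) / (√(2 * a) * √‖z‖ * √(L - τ)) :=
            div_le_div_of_nonneg_left (by positivity) e4 e3
        _ = _ := by field_simp
    · have : ¬ ‖z‖ < a * (t - τ) := fun h => hlt ((key τ).1 h)
      simp [waveKernel, this]
  calc ∫⁻ τ in Set.Ioi (0 : ℝ), ENNReal.ofReal (waveKernel a z (t - τ))
      ≤ ∫⁻ τ in Set.Ioi (0 : ℝ), (Set.Ioo 0 L).indicator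
          (fun τ => ENNReal.ofReal (c * (L - τ) ^ (-(1 / 2) : ℝ))) τ :=
        setLIntegral_mono' measurableSet_Ioi hpt
    _ ≤ ∫⁻ τ in Set.Ioc 0 L, ENNReal.ofReal (c * (L - τ) ^ (-(1 / 2) : ℝ)) := by
        refine (setLIntegral_le_lintegral _ _).trans ?_
        rw [lintegral_indicator measurableSet_Ioo]
        exact lintegral_mono_set Set.Ioo_subset_Ioc_self
    _ = ENNReal.ofReal (∫ τ in Set.Ioc 0 L, c * (L - τ) ^ (-(1 / 2) : ℝ)) := by
        symm
        refine ofReal_integral_eq_lintegral_ofReal ?_ ?_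
        · exact ((intervalIntegrable_iff_integrableOn_Ioc_of_le h0.le).1 hi).const_mul c
        · filter_upwards [ae_restrict_mem measurableSet_Ioc] with τ hτ
          exact mul_nonneg hc0 (Real.rpow_nonneg (by linarith [hτ.2]) _)
    _ ≤ ENNReal.ofReal (waveBound a T z) := by
        apply ENNReal.ofReal_le_ofReal
        rw [← intervalIntegral.integral_of_le h0.le, intervalIntegral.integral_const_mul, hval,
          waveBound, if_pos hzT, hc]
        have : √L ≤ √T := Real.sqrt_le_sqrt (by
          have : 0 ≤ ‖z‖ / a := by positivity
          linarith)
        have h5 : 0 ≤ 1 / (2 * Real.pi * a) / √(2 * a) * ‖z‖ ^ (-(1 / 2) : ℝ) := by positivity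
        nlinarith [mul_le_mul_of_nonneg_left this h5]

lemma integrable_norm_rpow_ball {s : ℝ} (hs : s < 2) (c : ℝ) :
    Integrable fun z : Plane => if ‖z‖ < c then ‖z‖ ^ (-s) else 0 := by
  have h := integrable_fun_norm_addHaar (volume : Measure Plane)
    (f := fun r : ℝ => if r < c then r ^ (-s) else 0)
  rw [h]
  have h1 : IntegrableOn (fun r : ℝ => r ^ (1 - s)) (Set.Ioo 0 c) := by
    rcases le_or_gt c 0 with hc | hc
    · simp [Set.Ioo_eq_empty (not_lt.2 hc)]
    · exact ((intervalIntegrable_iff_integrableOn_Ioo_of_le hc.le).1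
        (intervalIntegral.intervalIntegrable_rpow' (by linarith)))
  have h2 : IntegrableOn ((Set.Ioo 0 c).indicator fun r : ℝ => r ^ (1 - s)) (Set.Ioi 0) :=
    ((integrable_indicator_iff measurableSet_Ioo).2 h1).integrableOn
  refine h2.congr_fun (fun r hr => ?_) measurableSet_Ioi
  have hr' : 0 < r := hr
  simp only [finrank_euclideanSpace, Fintype.card_fin, Set.indicator, Set.mem_Ioo, hr', true_and]
  split_ifs
  · rw [sub_eq_add_neg, Real.rpow_add hr', Real.rpow_one]
    simp
  · simp

lemma integrable_waveBound (a T : ℝ) : Integrable (waveBound a T) :=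
  (integrable_norm_rpow_ball (s := 1 / 2) (by norm_num) (a * T)).const_mul _

/-- The square behaves like ‖z‖ ^ (-1), still integrable near the origin of the plane; the
second-moment argument depends on this. -/
lemma integrable_waveBound_sq (a T : ℝ) : Integrable fun z => waveBound a T z ^ 2 := by
  have h := (integrable_norm_rpow_ball (s := 1) (by norm_num) (a * T)).const_mul
    ((1 / (2 * Real.pi * a) / Real.sqrt (2 * a) * (2 * Real.sqrt T)) ^ 2)
  refine h.congr (Eventually.of_forall fun z => ?_)
  simp only [waveBound, mul_pow]
  split_ifs
  · rw [← Real.rpow_natCast (‖z‖ ^ _), ← Real.rpow_mul (norm_nonneg z)]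
    norm_num
  · simp

end KernelBounds

lemma measurable_waveKernel_comp {β : Type*} [MeasurableSpace β] {f : β → Plane} {g : β → ℝ}
    (hf : Measurable f) (hg : Measurable g) (a : ℝ) :
    Measurable fun x => waveKernel a (f x) (g x) := by
  have h := (measurable_waveKernel a).comp (hf.prodMk hg)
  simpa only [Function.comp_def] using h

/-! ### Poisson's kernel: moments, measurability and the identity for one source point. -/

section PoissonKernel

variable {a : ℝ} {σ : Plane → ℝ → ℝ}

lemma enorm_poissonKernel_le (ha : 0 < a) {C : ℝ} (hC : ∀ x t, 0 ≤ t → |σ x t| ≤ C)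
    {x y : Plane} (hxy : x ≠ y) {t T : ℝ} (ht : t ≤ T) :
    ‖poissonKernel a σ x y t‖ₑ ≤ ENNReal.ofReal C * ENNReal.ofReal (waveBound a T (x - y)) := by
  rw [poissonKernel_eq ha]
  refine (enorm_integral_le_lintegral_enorm _).trans ?_
  calc ∫⁻ τ in Set.Ioi (0 : ℝ), ‖waveKernel a (x - y) (t - τ) * σ y τ‖ₑ
      ≤ ∫⁻ τ in Set.Ioi (0 : ℝ),
          ENNReal.ofReal C * ENNReal.ofReal (waveKernel a (x - y) (t - τ)) := by
        refine setLIntegral_mono' measurableSet_Ioi fun τ hτ => ?_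
        rw [enorm_mul, mul_comm, Real.enorm_of_nonneg (waveKernel_nonneg ha _ _),
          Real.enorm_eq_ofReal_abs]
        gcongr
        exact hC _ _ (le_of_lt hτ)
    _ = ENNReal.ofReal C * ∫⁻ τ in Set.Ioi (0 : ℝ),
          ENNReal.ofReal (waveKernel a (x - y) (t - τ)) := by
        refine lintegral_const_mul _ ?_
        exact (measurable_waveKernel_comp (by fun_prop) (by fun_prop) a).ennreal_ofReal
    _ ≤ _ := by
        gcongr
        exact lintegral_waveKernel_le ha ht (sub_ne_zero.2 hxy)

lemma poissonKernel_congr (ha : 0 < a) {σ' : Plane → ℝ → ℝ}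
    (h : ∀ y τ, 0 ≤ τ → σ y τ = σ' y τ) (x y : Plane) (t : ℝ) :
    poissonKernel a σ x y t = poissonKernel a σ' x y t := by
  rw [poissonKernel_eq ha, poissonKernel_eq ha]
  refine setIntegral_congr_fun measurableSet_Ioi fun τ hτ => ?_
  have hτ' : 0 < τ := hτ
  simp only [h y τ hτ'.le]

/-- Freezing the time at 0 for negative times gives a globally continuous function, although `σ`
itself is arbitrary there. -/
lemma continuous_extend_const
    (hσ : ContinuousOn (Function.uncurry σ) (Set.univ ×ˢ Set.Ici (0 : ℝ))) :
    Continuous fun p : Plane × ℝ => σ p.1 (max p.2 0) :=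
  hσ.comp_continuous (f := fun p : Plane × ℝ => (p.1, max p.2 0)) (by fun_prop)
    (fun p => ⟨trivial, le_max_right p.2 0⟩)

lemma measurable_poissonKernel (ha : 0 < a)
    (hσ : ContinuousOn (Function.uncurry σ) (Set.univ ×ˢ Set.Ici (0 : ℝ))) :
    Measurable fun q : Plane × (Plane × ℝ) => poissonKernel a σ q.2.1 q.1 q.2.2 := by
  have hc := continuous_extend_const hσ
  have e : (fun q : Plane × (Plane × ℝ) => poissonKernel a σ q.2.1 q.1 q.2.2) = fun q =>
      ∫ τ in Set.Ioi (0 : ℝ), waveKernel a (q.2.1 - q.1) (q.2.2 - τ) * σ q.1 (max τ 0) := by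
    funext q
    rw [poissonKernel_congr ha (σ' := fun y τ => σ y (max τ 0))
      (fun y τ hτ => by rw [max_eq_left hτ]), poissonKernel_eq ha]
  rw [e]
  refine (StronglyMeasurable.integral_prod_right' (f := fun r : (Plane × (Plane × ℝ)) × ℝ =>
    waveKernel a (r.1.2.1 - r.1.1) (r.1.2.2 - r.2) * σ r.1.1 (max r.2 0)) ?_).measurable
  refine (Measurable.mul ?_ ?_).stronglyMeasurable
  · exact measurable_waveKernel_comp (by fun_prop) (by fun_prop) a
  · have k : Measurable fun r : (Plane × (Plane × ℝ)) × ℝ => (r.1.1, r.2) := by fun_prop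
    exact hc.measurable.comp k

lemma restrict_univ_prod (s : Set ℝ) :
    (volume : Measure (Plane × ℝ)).restrict (Set.univ ×ˢ s) =
      (volume : Measure Plane).prod (volume.restrict s) := by
  rw [Measure.volume_eq_prod, ← Measure.prod_restrict, Measure.restrict_univ]

lemma ae_fst_ne (y : Plane) (s : Set ℝ) :
    ∀ᵐ p ∂(volume : Measure (Plane × ℝ)).restrict (Set.univ ×ˢ s), p.1 ≠ y := by
  rw [restrict_univ_prod]
  have h : ∀ᵐ x ∂(volume : Measure Plane), x ≠ y := by simp [ae_iff]
  exact Measure.quasiMeasurePreserving_fst.ae h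

/-- The space-time cylinders that exhaust the half-space `t > 0`. -/
def cylinder (n : ℝ) : Set (Plane × ℝ) := Metric.closedBall 0 n ×ˢ Set.Ioo 0 n

lemma measurableSet_cylinder (n : ℝ) : MeasurableSet (cylinder n) :=
  measurableSet_closedBall.prod measurableSet_Ioo

lemma volume_cylinder_lt_top (n : ℝ) : volume (cylinder n) < ⊤ := by
  rw [cylinder, Measure.volume_eq_prod, Measure.prod_prod]
  exact ENNReal.mul_lt_top measure_closedBall_lt_top (by simp)

/-- By finite speed of propagation a source outside the ball of radius `n + a * n` does not reach
the cylinder. Inside it, translation invariance makes the bound independent of `y`. -/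
lemma lintegral_poissonKernel_pow_le (ha : 0 < a) {C : ℝ} (hC : ∀ x t, 0 ≤ t → |σ x t| ≤ C)
    (n : ℝ) (k : ℕ) (hk : k ≠ 0) (hfin : ∫⁻ z, ENNReal.ofReal (waveBound a n z) ^ k ≠ ⊤) :
    ∃ B : ENNReal, B ≠ ⊤ ∧ ∀ y, ∫⁻ p in cylinder n, ‖poissonKernel a σ p.1 y p.2‖ₑ ^ k ≤
      (Metric.closedBall 0 (n + a * n)).indicator (fun _ => B) y := by
  refine ⟨(ENNReal.ofReal C) ^ k * ((∫⁻ z, ENNReal.ofReal (waveBound a n z) ^ k) *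
    ENNReal.ofReal n), ?_, fun y => ?_⟩
  · exact ENNReal.mul_ne_top (by simp) (ENNReal.mul_ne_top hfin (by simp))
  by_cases hy : y ∈ Metric.closedBall 0 (n + a * n)
  · rw [Set.indicator_of_mem hy]
    calc ∫⁻ p in cylinder n, ‖poissonKernel a σ p.1 y p.2‖ₑ ^ k
        ≤ ∫⁻ p in Set.univ ×ˢ Set.Ioo 0 n, ‖poissonKernel a σ p.1 y p.2‖ₑ ^ k :=
          lintegral_mono_set (Set.prod_mono (Set.subset_univ _) le_rfl)
      _ ≤ ∫⁻ p in Set.univ ×ˢ Set.Ioo 0 n,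
            ENNReal.ofReal C ^ k * (ENNReal.ofReal (waveBound a n (p.1 - y)) ^ k * 1) := by
          refine lintegral_mono_ae ?_
          filter_upwards [ae_fst_ne y (Set.Ioo 0 n),
            ae_restrict_mem (MeasurableSet.univ.prod measurableSet_Ioo)] with p hp hpm
          rw [mul_one, ← mul_pow]
          gcongr
          exact enorm_poissonKernel_le ha hC hp hpm.2.2.le
      _ = _ := by
          have hm : Measurable fun x => ENNReal.ofReal (waveBound a n (x - y)) ^ k :=
            (((measurable_waveBound a n).comp
              (measurable_id.sub_const y)).ennreal_ofReal).pow_const k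
          have hm' : Measurable fun p : Plane × ℝ =>
              ENNReal.ofReal (waveBound a n (p.1 - y)) ^ k * 1 :=
            (hm.comp measurable_fst).mul_const 1
          rw [lintegral_const_mul _ hm', restrict_univ_prod,
            lintegral_prod_mul (f := fun x => ENNReal.ofReal (waveBound a n (x - y)) ^ k)
              (g := fun _ => 1) hm.aemeasurable aemeasurable_const,
            lintegral_sub_right_eq_self (fun x => ENNReal.ofReal (waveBound a n x) ^ k)]
          simp
  · rw [Set.indicator_of_notMem hy]
    refine le_of_eq ?_
    rw [setLIntegral_congr_fun (g := fun _ => 0) (measurableSet_cylinder n), lintegral_zero]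
    rintro ⟨x, t⟩ ⟨hx, ht⟩
    simp only [Metric.mem_closedBall, dist_zero_right, not_le] at hx hy
    have : ¬ ‖x - y‖ < a * t := by
      have h1 := norm_sub_norm_le y x
      rw [norm_sub_rev] at h1
      have : a * t ≤ a * n := mul_le_mul_of_nonneg_left ht.2.le ha.le
      linarith
    simp [poissonKernel, this, hk]

lemma lintegral_poissonKernel_le (ha : 0 < a) {C : ℝ} (hC : ∀ x t, 0 ≤ t → |σ x t| ≤ C) (n : ℝ) :
    ∃ B : ENNReal, B ≠ ⊤ ∧ ∀ y, ∫⁻ p in cylinder n, ‖poissonKernel a σ p.1 y p.2‖ₑ ≤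
      (Metric.closedBall 0 (n + a * n)).indicator (fun _ => B) y := by
  have h := lintegral_poissonKernel_pow_le ha hC n 1 one_ne_zero ?_
  · simpa using h
  · simp only [pow_one]
    rw [← ofReal_integral_eq_lintegral_ofReal (integrable_waveBound a n)
      (Eventually.of_forall (waveBound_nonneg ha n))]
    simp

lemma lintegral_poissonKernel_sq_le (ha : 0 < a) {C : ℝ} (hC : ∀ x t, 0 ≤ t → |σ x t| ≤ C)
    (n : ℝ) :
    ∃ B : ENNReal, B ≠ ⊤ ∧ ∀ y, ∫⁻ p in cylinder n, ‖poissonKernel a σ p.1 y p.2‖ₑ ^ 2 ≤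
      (Metric.closedBall 0 (n + a * n)).indicator (fun _ => B) y := by
  refine lintegral_poissonKernel_pow_le ha hC n 2 two_ne_zero ?_
  simp_rw [← ENNReal.ofReal_pow (waveBound_nonneg ha n _)]
  rw [← ofReal_integral_eq_lintegral_ofReal (integrable_waveBound_sq a n)
    (Eventually.of_forall fun z => sq_nonneg _)]
  simp

/-- The kernel lives at t > τ > 0, where `θ` may be replaced by a smooth extension. This is why no
boundary term at t = 0 appears. -/
lemma IsTestFunction.integral_waveKernel_shift {θ : Plane → ℝ → ℝ} (hθ : IsTestFunction θ)
    (ha : 0 < a) (y : Plane) {τ : ℝ} (hτ : 0 < τ) :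
    ∫ t in Set.Ioi (0 : ℝ), ∫ x, waveKernel a (x - y) (t - τ) * waveOperator a θ x t = θ y τ := by
  obtain ⟨f, hf, hfc, hfθ⟩ := hθ.exists_extension (τ := τ / 2) (by linarith)
  have hz : ∀ s ≤ 0, ∀ z, waveKernel a z s = 0 := by
    intro s hs z
    have : ¬ ‖z‖ < a * s := by nlinarith [norm_nonneg z]
    simp [waveKernel, this]
  have e1 : ∀ t, ∫ x, waveKernel a (x - y) (t - τ) * waveOperator a θ x t =
      ∫ z, waveKernel a z (t - τ) * waveOperator a (fun x t => f (x, t)) (y + z) t := by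
    intro t
    rw [← integral_add_left_eq_self _ y]
    refine integral_congr_ae (Eventually.of_forall fun z => ?_)
    rcases le_or_gt t τ with h | h
    · simp only [hz (t - τ) (by linarith), zero_mul]
    · simp only [add_sub_cancel_left]
      rw [waveOperator_congr (θ' := fun x t => f (x, t)) a
        (hfθ (y + z, t) (by simp only; linarith))]
  simp_rw [e1]
  rw [setIntegral_eq_integral_of_forall_compl_eq_zero]
  · rw [← integral_add_left_eq_self _ τ,
      ← setIntegral_eq_integral_of_forall_compl_eq_zero (s := Set.Ioi 0)]
    · simp only [add_sub_cancel_left]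
      rw [integral_waveKernel_mul_waveOperator hf hfc ha y τ]
      exact ((hfθ (y, τ) (by simp only; linarith)).eq_of_nhds).symm
    · intro s hs
      have : s ≤ 0 := not_lt.1 hs
      simp [hz s this]
  · intro t ht
    have : t ≤ 0 := not_lt.1 ht
    simp [hz (t - τ) (by linarith)]

/-- Tested against the wave operator, Poisson's kernel of the source `σ(y, ·)` concentrated at `y`
reproduces the source. -/
theorem integral_poissonKernel_mul_waveOperator (ha : 0 < a)
    (hS1 : ∃ C : ℝ, ∀ x t, 0 ≤ t → |σ x t| ≤ C)
    (hσ : ContinuousOn (Function.uncurry σ) (Set.univ ×ˢ Set.Ici (0 : ℝ)))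
    {θ : Plane → ℝ → ℝ} (hθ : IsTestFunction θ) (y : Plane) :
    ∫ p in Set.univ ×ˢ Set.Ioi (0 : ℝ), poissonKernel a σ p.1 y p.2 * waveOperator a θ p.1 p.2 =
      ∫ τ in Set.Ioi (0 : ℝ), θ y τ * σ y τ := by
  obtain ⟨C, hC⟩ := hS1
  obtain ⟨D, R, hD0, hR0, -, hD, -, hsupp⟩ := hθ.exists_bound a
  set μ := (volume : Measure (Plane × ℝ)).restrict (Set.univ ×ˢ Set.Ioi (0 : ℝ)) with hμ
  set ν := (volume : Measure ℝ).restrict (Set.Ioi 0) with hν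
  have hμν : μ = (volume : Measure Plane).prod ν := restrict_univ_prod _
  have hms : MeasurableSet ((Set.univ : Set Plane) ×ˢ Set.Ioi (0 : ℝ)) :=
    MeasurableSet.univ.prod measurableSet_Ioi
  let H : (Plane × ℝ) × ℝ → ℝ := fun q =>
    waveKernel a (q.1.1 - y) (q.1.2 - q.2) * σ y q.2 * waveOperator a θ q.1.1 q.1.2
  have hWm : AEStronglyMeasurable (fun p : Plane × ℝ => waveOperator a θ p.1 p.2) μ :=
    (hθ.continuousOn_waveOperator a).aestronglyMeasurable hms
  have hσm : AEStronglyMeasurable (fun τ => σ y τ) ν :=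
    (hσ.comp (f := fun τ : ℝ => (y, τ)) (by fun_prop)
      (fun τ hτ => ⟨trivial, le_of_lt hτ⟩)).aestronglyMeasurable measurableSet_Ioi
  have hkm : Measurable fun q : (Plane × ℝ) × ℝ => waveKernel a (q.1.1 - y) (q.1.2 - q.2) :=
    measurable_waveKernel_comp (by fun_prop) (by fun_prop) a
  have hHm : AEStronglyMeasurable H (μ.prod ν) :=
    (hkm.aestronglyMeasurable.mul hσm.comp_snd).mul hWm.comp_fst
  have hdom : Integrable (fun p : Plane × ℝ =>
      waveBound a R (p.1 - y) * (Set.Iio R).indicator (fun _ => (1 : ℝ)) p.2) μ := by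
    rw [hμν]
    refine Integrable.mul_prod (f := fun x => waveBound a R (x - y))
      (g := (Set.Iio R).indicator fun _ => (1 : ℝ)) ((integrable_waveBound a R).comp_sub_right y) ?_
    rw [integrable_indicator_iff measurableSet_Iio, IntegrableOn, hν,
      Measure.restrict_restrict measurableSet_Iio]
    refine integrableOn_const (hs := ?_)
    rw [Set.inter_comm, Set.Ioi_inter_Iio]
    simp
  -- Fubini is justified by integrating in τ first, where `waveBound` majorizes the kernel; the
  -- support of the wave operator confines t to `t < R`.
  have hHi : Integrable H (μ.prod ν) := by
    refine ⟨hHm, ?_⟩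
    rw [HasFiniteIntegral, lintegral_prod _ hHm.enorm]
    refine lt_of_le_of_lt (lintegral_mono_ae (g := fun p => ENNReal.ofReal C * ENNReal.ofReal D *
      ENNReal.ofReal (waveBound a R (p.1 - y) *
        (Set.Iio R).indicator (fun _ => (1 : ℝ)) p.2)) ?_) ?_
    · filter_upwards [ae_fst_ne y (Set.Ioi 0), ae_restrict_mem hms] with p hp hpm
      have hp2 : 0 < p.2 := hpm.2
      by_cases hpR : p.2 < R
      · rw [Set.indicator_of_mem (show p.2 ∈ Set.Iio R from hpR), mul_one]
        calc ∫⁻ τ, ‖H (p, τ)‖ₑ ∂ν ≤ ∫⁻ τ, ENNReal.ofReal C * ENNReal.ofReal D *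
              ENNReal.ofReal (waveKernel a (p.1 - y) (p.2 - τ)) ∂ν := by
              refine setLIntegral_mono' measurableSet_Ioi fun τ hτ => ?_
              have h1 : ‖σ y τ‖ₑ ≤ ENNReal.ofReal C := by
                rw [Real.enorm_eq_ofReal_abs]
                exact ENNReal.ofReal_le_ofReal (hC _ _ (le_of_lt hτ))
              have h2 : ‖waveOperator a θ p.1 p.2‖ₑ ≤ ENNReal.ofReal D := by
                rw [Real.enorm_eq_ofReal_abs]
                exact ENNReal.ofReal_le_ofReal (hD _ _ hp2)
              simp only [H, enorm_mul, Real.enorm_of_nonneg (waveKernel_nonneg ha _ _)]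
              rw [mul_assoc, mul_comm]
              gcongr
          _ = ENNReal.ofReal C * ENNReal.ofReal D *
              ∫⁻ τ, ENNReal.ofReal (waveKernel a (p.1 - y) (p.2 - τ)) ∂ν := by
              refine lintegral_const_mul _ ?_
              exact (measurable_waveKernel_comp (by fun_prop) (by fun_prop) a).ennreal_ofReal
          _ ≤ _ := by
              gcongr
              exact lintegral_waveKernel_le ha hpR.le (sub_ne_zero.2 hp)
      · have : waveOperator a θ p.1 p.2 = 0 := hsupp _ _ hp2 (fun h => hpR h.2)
        simp [H, this]
    · rw [lintegral_const_mul' _ _ (by finiteness)]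
      refine ENNReal.mul_lt_top (by finiteness) ?_
      rw [← ofReal_integral_eq_lintegral_ofReal hdom]
      · exact ENNReal.ofReal_lt_top
      · refine Eventually.of_forall fun p => mul_nonneg (waveBound_nonneg ha _ _) ?_
        exact Set.indicator_nonneg (fun _ _ => zero_le_one) _
  have e1 : ∀ p : Plane × ℝ, poissonKernel a σ p.1 y p.2 * waveOperator a θ p.1 p.2 =
      ∫ τ, H (p, τ) ∂ν := by
    intro p
    rw [poissonKernel_eq ha, ← integral_mul_const]
  simp_rw [e1]
  -- With τ outermost, each slice is the fundamental-solution identity with vertex (y, τ).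
  rw [integral_integral_swap (f := fun p τ => H (p, τ)) hHi]
  refine integral_congr_ae ?_
  filter_upwards [hHi.prod_left_ae, ae_restrict_mem measurableSet_Ioi] with τ hτi hτ
  rw [hμν] at hτi ⊢
  rw [integral_prod_symm _ hτi]
  have e2 : ∀ t : ℝ, ∫ x, H ((x, t), τ) =
      σ y τ * ∫ x, waveKernel a (x - y) (t - τ) * waveOperator a θ x t := by
    intro t
    rw [← integral_const_mul]
    refine integral_congr_ae (Eventually.of_forall fun x => ?_)
    simp only [H]
    ring
  simp_rw [e2]
  rw [integral_const_mul, hθ.integral_waveKernel_shift ha y hτ, mul_comm]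

end PoissonKernel

/-! ### Summability of heavy-tailed terms by truncation. -/

section Truncation

lemma antitoneOn_min_one_rpow {p y : ℝ} (hp : 0 ≤ p) (hy : 0 ≤ y) :
    AntitoneOn (fun x : ℝ => min 1 (x ^ (-p) * y)) (Set.Ioi 0) := by
  intro u hu v hv huv
  have hu' : 0 < u := hu
  refine min_le_min le_rfl (mul_le_mul_of_nonneg_right ?_ hy)
  exact Real.rpow_le_rpow_of_nonpos hu' huv (by linarith)

lemma lintegral_min_one_rpow_le {p y : ℝ} (hp : 1 < p) (hy : 0 < y) :
    ∫⁻ x in Set.Ioi (0 : ℝ), ENNReal.ofReal (min 1 (x ^ (-p) * y)) ≤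
      ENNReal.ofReal (p / (p - 1) * y ^ (1 / p)) := by
  -- At `n` the two entries of the minimum coincide. The parts below and above contribute at most
  -- `n` and `n / (p - 1)`, which add up to the constant.
  set n := y ^ (1 / p) with hn
  have hn0 : 0 < n := Real.rpow_pos_of_pos hy _
  have hnp : n ^ p = y := by
    rw [hn, ← Real.rpow_mul hy.le, one_div, inv_mul_cancel₀ (by linarith), Real.rpow_one]
  have h1 : ∫⁻ x in Set.Ioc 0 n, ENNReal.ofReal (min 1 (x ^ (-p) * y)) ≤ ENNReal.ofReal n := by
    calc ∫⁻ x in Set.Ioc 0 n, ENNReal.ofReal (min 1 (x ^ (-p) * y))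
        ≤ ∫⁻ _ in Set.Ioc 0 n, 1 := by
          refine lintegral_mono fun x => ?_
          rw [← ENNReal.ofReal_one]
          exact ENNReal.ofReal_le_ofReal (min_le_left _ _)
      _ = ENNReal.ofReal n := by simp
  have h2 : ∫⁻ x in Set.Ioi n, ENNReal.ofReal (min 1 (x ^ (-p) * y)) ≤
      ENNReal.ofReal (n / (p - 1)) := by
    have hi : IntegrableOn (fun x : ℝ => x ^ (-p) * y) (Set.Ioi n) :=
      (integrableOn_Ioi_rpow_of_lt (by linarith) hn0).mul_const y
    calc ∫⁻ x in Set.Ioi n, ENNReal.ofReal (min 1 (x ^ (-p) * y))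
        ≤ ∫⁻ x in Set.Ioi n, ENNReal.ofReal (x ^ (-p) * y) :=
          lintegral_mono fun x => ENNReal.ofReal_le_ofReal (min_le_right _ _)
      _ = ENNReal.ofReal (∫ x in Set.Ioi n, x ^ (-p) * y) := by
          symm
          refine ofReal_integral_eq_lintegral_ofReal hi ?_
          filter_upwards [ae_restrict_mem measurableSet_Ioi] with x hx
          have hx' : n < x := hx
          exact mul_nonneg (Real.rpow_nonneg (by linarith) _) hy.le
      _ = ENNReal.ofReal (n / (p - 1)) := by
          rw [integral_mul_const, integral_Ioi_rpow_of_lt (by linarith) hn0]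
          congr 1
          have : n ^ (-p + 1) = n / y := by
            rw [← hnp, Real.rpow_add hn0, Real.rpow_neg hn0.le, Real.rpow_one]
            field_simp
          have hp1 : p - 1 ≠ 0 := by linarith
          have hp2 : -p + 1 ≠ 0 := by linarith
          rw [this]
          field_simp
          ring
  have h3 : Set.Ioi (0 : ℝ) = Set.Ioc 0 n ∪ Set.Ioi n := (Set.Ioc_union_Ioi_eq_Ioi hn0.le).symm
  rw [h3]
  refine (lintegral_union_le _ _ _).trans ((add_le_add h1 h2).trans ?_)
  rw [← ENNReal.ofReal_add hn0.le (div_nonneg hn0.le (by linarith))]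
  apply ENNReal.ofReal_le_ofReal
  have hp1 : p - 1 ≠ 0 := by linarith
  apply le_of_eq
  field_simp
  ring

lemma tsum_min_one_rpow_le {p y : ℝ} (hp : 1 < p) (hy : 0 ≤ y) :
    ∑' k : ℕ, ENNReal.ofReal (min 1 (((k : ℝ) + 1) ^ (-p) * y)) ≤
      ENNReal.ofReal (p / (p - 1)) * ENNReal.ofReal (y ^ (1 / p)) := by
  rcases hy.eq_or_lt with rfl | hy'
  · simp
  have hanti := antitoneOn_min_one_rpow (p := p) (by linarith) hy
  have hdisj : Pairwise (Function.onFun Disjoint fun k : ℕ => Set.Ioc (k : ℝ) ((k : ℝ) + 1)) := by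
    have := (Nat.mono_cast (α := ℝ)).pairwise_disjoint_on_Ioc_succ
    simpa using this
  calc ∑' k : ℕ, ENNReal.ofReal (min 1 (((k : ℝ) + 1) ^ (-p) * y))
      ≤ ∑' k : ℕ, ∫⁻ x in Set.Ioc (k : ℝ) ((k : ℝ) + 1),
          ENNReal.ofReal (min 1 (x ^ (-p) * y)) := by
        refine ENNReal.tsum_le_tsum fun k => ?_
        have hk : (0 : ℝ) ≤ k := Nat.cast_nonneg k
        calc ENNReal.ofReal (min 1 (((k : ℝ) + 1) ^ (-p) * y))
            = ∫⁻ _ in Set.Ioc (k : ℝ) ((k : ℝ) + 1),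
                ENNReal.ofReal (min 1 (((k : ℝ) + 1) ^ (-p) * y)) := by simp
          _ ≤ _ := by
              refine setLIntegral_mono' measurableSet_Ioc fun x hx => ?_
              apply ENNReal.ofReal_le_ofReal
              exact hanti (show 0 < x by linarith [hx.1]) (show (0 : ℝ) < k + 1 by linarith) hx.2
    _ = ∫⁻ x in ⋃ k : ℕ, Set.Ioc (k : ℝ) ((k : ℝ) + 1), ENNReal.ofReal (min 1 (x ^ (-p) * y)) :=
        (lintegral_iUnion (fun _ => measurableSet_Ioc) hdisj _).symm
    _ ≤ ∫⁻ x in Set.Ioi (0 : ℝ), ENNReal.ofReal (min 1 (x ^ (-p) * y)) := by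
        refine lintegral_mono_set (Set.iUnion_subset fun k x hx => ?_)
        have hk : (0 : ℝ) ≤ k := Nat.cast_nonneg k
        exact lt_of_le_of_lt hk hx.1
    _ ≤ ENNReal.ofReal (p / (p - 1) * y ^ (1 / p)) := lintegral_min_one_rpow_le hp hy'
    _ = _ := ENNReal.ofReal_mul (div_nonneg (by linarith) (by linarith))

variable {Ω : Type*} [MeasurableSpace Ω] {P : Measure Ω}

/-- Identically distributed nonnegative variables with a finite moment of order `1 / p < 1` are
summable against the weights `(k + 1) ^ (-p)`. -/
lemma ae_summable_rpow_mul {p : ℝ} (hp : 1 < p) {Y : ℕ → Ω → ℝ} (hY : ∀ k, Measurable (Y k))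
    (hY0 : ∀ k ω, 0 ≤ Y k ω) (hid : ∀ k, IdentDistrib (Y k) (Y 0) P P)
    (hfin : ∫⁻ ω, ENNReal.ofReal (Y 0 ω ^ (1 / p)) ∂P ≠ ⊤) :
    ∀ᵐ ω ∂P, Summable fun k : ℕ => ((k : ℝ) + 1) ^ (-p) * Y k ω := by
  have hmeas : ∀ k : ℕ, Measurable fun y : ℝ =>
      ENNReal.ofReal (min 1 (((k : ℝ) + 1) ^ (-p) * y)) := fun k => by fun_prop
  have hmeasY : ∀ j k : ℕ, AEMeasurable (fun ω =>
      ENNReal.ofReal (min 1 (((k : ℝ) + 1) ^ (-p) * Y j ω))) P :=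
    fun j k => ((hmeas k).comp (hY j)).aemeasurable
  -- Equality of laws allows `Y 0` in every term; the sum then sits inside the expectation and is at
  -- most a constant times `Y 0 ^ (1 / p)`. No independence is needed.
  have htot : ∫⁻ ω, ∑' k : ℕ, ENNReal.ofReal (min 1 (((k : ℝ) + 1) ^ (-p) * Y k ω)) ∂P ≠ ⊤ := by
    rw [lintegral_tsum fun k => hmeasY k k]
    have h1 : ∀ k : ℕ, ∫⁻ ω, ENNReal.ofReal (min 1 (((k : ℝ) + 1) ^ (-p) * Y k ω)) ∂P =
        ∫⁻ ω, ENNReal.ofReal (min 1 (((k : ℝ) + 1) ^ (-p) * Y 0 ω)) ∂P :=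
      fun k => ((hid k).comp (hmeas k)).lintegral_eq
    simp_rw [h1]
    rw [← lintegral_tsum fun k => hmeasY 0 k]
    refine ne_top_of_le_ne_top ?_ (lintegral_mono fun ω => tsum_min_one_rpow_le hp (hY0 0 ω))
    rw [lintegral_const_mul' _ _ (by finiteness)]
    exact ENNReal.mul_ne_top (by finiteness) hfin
  have hae := ae_lt_top' (AEMeasurable.tsum fun k => hmeasY k k) htot
  filter_upwards [hae] with ω hω
  have hpos : ∀ k : ℕ, 0 ≤ ((k : ℝ) + 1) ^ (-p) * Y k ω := fun k =>
    mul_nonneg (Real.rpow_nonneg (by positivity) _) (hY0 k ω)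
  have hs : Summable fun k : ℕ => min 1 (((k : ℝ) + 1) ^ (-p) * Y k ω) := by
    have := ENNReal.summable_toReal hω.ne
    refine this.congr fun k => ?_
    exact ENNReal.toReal_ofReal (le_min zero_le_one (hpos k))
  -- Summable terms tend to zero, so the truncation is eventually inactive.
  have hlt : ∀ᶠ k : ℕ in atTop, min 1 (((k : ℝ) + 1) ^ (-p) * Y k ω) < 1 :=
    hs.tendsto_atTop_zero.eventually (gt_mem_nhds zero_lt_one)
  refine Summable.of_norm_bounded_eventually_nat hs ?_
  filter_upwards [hlt] with k hk
  rw [Real.norm_of_nonneg (hpos k)]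
  rcases min_lt_iff.1 hk with h | h
  · exact absurd h (lt_irrefl _)
  · rw [min_eq_right h.le]

end Truncation

/-! ### Arrival times, the common Gaussian law and local summability of the weights. -/

lemma sum_interarrival {Ω : Type*} (Γ : ℕ → Ω → ℝ) (ω : Ω) (k : ℕ) :
    ∑ j ∈ Finset.range (k + 1), interarrival Γ j ω = Γ k ω := by
  induction k with
  | zero => simp [interarrival]
  | succ k ih => rw [Finset.sum_range_succ, ih]; simp [interarrival]

section LePageSystem

variable {Ω : Type*} [MeasurableSpace Ω] {P : Measure Ω} {α : ℝ}
  {φ : Plane → ℝ} {Γ : ℕ → Ω → ℝ} {ξ : ℕ → Ω → Plane} {g : ℕ → Ω → ℝ}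

lemma IsLePageSystem.measurable_interarrival (hM : IsLePageSystem P α φ Γ ξ g) (k : ℕ) :
    Measurable (interarrival Γ k) := by
  cases k with
  | zero => exact hM.measurable_arrival 0
  | succ k => exact (hM.measurable_arrival (k + 1)).sub (hM.measurable_arrival k)

lemma expMeasure_Iic_zero : expMeasure 1 (Set.Iic 0) = 0 := by
  have := isProbabilityMeasure_expMeasure (zero_lt_one' ℝ)
  have h := cdf_expMeasure_eq (zero_lt_one' ℝ) 0
  rw [cdf_eq_real] at h
  simp only [le_refl, if_true, mul_zero, neg_zero, Real.exp_zero, sub_self] at h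
  exact (measureReal_eq_zero_iff).1 h

lemma IsLePageSystem.ae_interarrival_pos (hM : IsLePageSystem P α φ Γ ξ g) :
    ∀ᵐ ω ∂P, ∀ k, 0 < interarrival Γ k ω := by
  refine ae_all_iff.2 fun k => ?_
  have h : ∀ᵐ x ∂P.map (interarrival Γ k), 0 < x := by
    rw [hM.law_interarrival k, ae_iff]
    simp only [not_lt]
    exact expMeasure_Iic_zero
  exact ae_of_ae_map (hM.measurable_interarrival k).aemeasurable h

lemma IsLePageSystem.ae_arrival_pos (hM : IsLePageSystem P α φ Γ ξ g) :
    ∀ᵐ ω ∂P, ∀ k, 0 < Γ k ω := by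
  filter_upwards [hM.ae_interarrival_pos] with ω hω k
  rw [← sum_interarrival Γ ω k]
  exact Finset.sum_pos (fun j _ => hω j) (by simp)

/-- The arrival times grow at least linearly. -/
lemma IsLePageSystem.ae_arrival_ge [IsProbabilityMeasure P] (hM : IsLePageSystem P α φ Γ ξ g) :
    ∀ᵐ ω ∂P, ∃ c : ℝ, 0 < c ∧ ∀ᶠ k : ℕ in atTop, c * ((k : ℝ) + 1) ≤ Γ k ω := by
  -- Clipped gaps are bounded, so the strong law applies without computing exponential moments; a
  -- positive mean suffices for a linear lower bound.
  set X : ℕ → Ω → ℝ := fun k ω => max 0 (min 1 (interarrival Γ k ω)) with hX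
  have htr : Measurable fun x : ℝ => max 0 (min 1 x) := by fun_prop
  have hXm : ∀ k, Measurable (X k) := fun k => htr.comp (hM.measurable_interarrival k)
  have hX0 : ∀ k ω, 0 ≤ X k ω := fun k ω => le_max_left _ _
  have hX1 : ∀ k ω, X k ω ≤ 1 := fun k ω => max_le zero_le_one (min_le_left _ _)
  have hXint : Integrable (X 0) P :=
    (integrable_const (1 : ℝ)).mono' (hXm 0).aestronglyMeasurable
      (Eventually.of_forall fun ω => by rw [Real.norm_of_nonneg (hX0 0 ω)]; exact hX1 0 ω)
  have hpos := hM.ae_interarrival_pos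
  have hmean : 0 < ∫ ω, X 0 ω ∂P := by
    rw [integral_pos_iff_support_of_nonneg (hX0 0) hXint]
    have : Function.support (X 0) =ᵐ[P] Set.univ := by
      rw [ae_eq_univ, ← mem_ae_iff]
      filter_upwards [hpos] with ω hω
      have : 0 < X 0 ω := lt_max_of_lt_right (lt_min zero_lt_one (hω 0))
      exact this.ne'
    rw [measure_congr this]
    simp
  have hlln := strong_law_ae_real X hXint
    (fun i j hij => (hM.indep_interarrival.indepFun hij).comp htr htr)
    (fun i => IdentDistrib.comp (u := fun x : ℝ => max 0 (min 1 x))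
      ⟨(hM.measurable_interarrival i).aemeasurable,
      (hM.measurable_interarrival 0).aemeasurable,
      by rw [hM.law_interarrival, hM.law_interarrival]⟩ htr)
  filter_upwards [hlln, hpos] with ω hω hp
  refine ⟨(∫ ω, X 0 ω ∂P) / 2, by linarith, ?_⟩
  have h1 := (tendsto_add_atTop_iff_nat 1).2 hω
  filter_upwards [h1.eventually (lt_mem_nhds (half_lt_self hmean))] with k hk
  rw [lt_div_iff₀ (by positivity)] at hk
  push_cast at hk
  refine hk.le.trans ?_
  rw [← sum_interarrival Γ ω k]
  refine Finset.sum_le_sum fun j _ => ?_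
  exact max_le (hp j).le (min_le_right _ _)

lemma integral_rpow_gaussianReal (v : NNReal) (α : ℝ) :
    ∫ x, |x| ^ α ∂gaussianReal 0 v = (Real.sqrt v) ^ α * ∫ x, |x| ^ α ∂gaussianReal 0 1 := by
  have h := gaussianReal_map_const_mul (μ := 0) (v := 1) (Real.sqrt v)
  have e : (⟨Real.sqrt v ^ 2, sq_nonneg _⟩ : NNReal) * 1 = v := by
    ext; simp
  rw [mul_zero] at h
  have h' : (gaussianReal 0 1).map (Real.sqrt v * ·) = gaussianReal 0 v := by
    rw [h]; congr 1
  rw [← h', integral_map (by fun_prop)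
      (by fun_prop : Measurable fun x : ℝ => |x| ^ α).aestronglyMeasurable,
    ← integral_const_mul]
  refine integral_congr_ae (Eventually.of_forall fun x => ?_)
  simp only [abs_mul, abs_of_nonneg (Real.sqrt_nonneg _)]
  exact Real.mul_rpow (Real.sqrt_nonneg _) (abs_nonneg x)

/-- By scaling, the α-th absolute moment is the α-th power of the standard deviation times that of
the standard normal. Fixing it to 1 fixes the variance. -/
lemma IsLePageSystem.exists_gaussian_law (hM : IsLePageSystem P α φ Γ ξ g) (hα : 0 < α) :
    ∃ v : NNReal, ∀ k, P.map (g k) = gaussianReal 0 v := by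
  obtain ⟨v, hv⟩ := hM.law_gaussian 0
  refine ⟨v, fun k => ?_⟩
  obtain ⟨w, hw⟩ := hM.law_gaussian k
  have key : ∀ (j : ℕ) (u : NNReal), P.map (g j) = gaussianReal 0 u →
      (Real.sqrt u) ^ α * ∫ x, |x| ^ α ∂gaussianReal 0 1 = 1 := by
    intro j u hu
    rw [← integral_rpow_gaussianReal, ← hu, integral_map (hM.measurable_gaussian j).aemeasurable
      (by fun_prop : Measurable fun x : ℝ => |x| ^ α).aestronglyMeasurable]
    exact hM.moment_gaussian j
  have h0 := key 0 v hv
  have h1 := key k w hw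
  have hm : ∫ x, |x| ^ α ∂gaussianReal 0 1 ≠ 0 := by
    intro h; rw [h, mul_zero] at h0; exact zero_ne_one h0
  have h2 : (Real.sqrt w) ^ α = (Real.sqrt v) ^ α := mul_right_cancel₀ hm (h1.trans h0.symm)
  have h3 : Real.sqrt w = Real.sqrt v :=
    (Real.rpow_left_inj (Real.sqrt_nonneg _) (Real.sqrt_nonneg _) hα.ne').1 h2
  have h4 : (w : ℝ) = v := (Real.sqrt_inj w.2 v.2).1 h3
  rw [hw, NNReal.coe_injective h4]

/-- Summability of the arrival weights against functions of the positions and of the Gaussian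
variables, localized in space. -/
lemma IsLePageSystem.ae_summable_weights [IsProbabilityMeasure P]
    (hM : IsLePageSystem P α φ Γ ξ g) (hα : 0 < α)
    {p : ℝ} (hp : 1 < p) {z : ℝ → ℝ} (hz : Measurable z) (hz0 : ∀ x, 0 ≤ z x)
    (hfin : ∫⁻ ω, ENNReal.ofReal (z (g 0 ω) ^ (1 / p)) ∂P ≠ ⊤) (R : ℝ) :
    ∀ᵐ ω ∂P, Summable fun k => Γ k ω ^ (-p) * (φ (ξ k ω) ^ (-p) *
      (Metric.closedBall 0 R).indicator (fun _ => 1) (ξ k ω) * z (g k ω)) := by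
  obtain ⟨v, hv⟩ := hM.exists_gaussian_law hα
  set u : Plane → ℝ := fun x => φ x ^ (-p) * (Metric.closedBall 0 R).indicator (fun _ => 1) x
    with hu
  have hind0 : ∀ x, 0 ≤ (Metric.closedBall (0 : Plane) R).indicator (fun _ => (1 : ℝ)) x :=
    fun x => Set.indicator_nonneg (fun _ _ => zero_le_one) x
  have hu0 : ∀ x, 0 ≤ u x := fun x =>
    mul_nonneg (Real.rpow_nonneg (hM.density_pos x).le _) (hind0 x)
  have hφm : Measurable φ := hM.continuous_density.measurable
  have hum : Measurable u :=
    (hφm.pow_const _).mul (measurable_const.indicator measurableSet_closedBall)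
  have hF : Measurable fun q : Plane × ℝ => u q.1 * z q.2 := by fun_prop
  have hind : ∀ k, IndepFun (ξ k) (g k) P := fun k =>
    hM.indep_position_gaussian.comp (measurable_pi_apply k) (measurable_pi_apply k)
  have hlaw : ∀ k, P.map (fun ω => (ξ k ω, g k ω)) =
      (volume.withDensity fun x => ENNReal.ofReal (φ x)).prod (gaussianReal 0 v) := by
    intro k
    rw [(indepFun_iff_map_prod_eq_prod_map_map (hM.measurable_position k).aemeasurable
      (hM.measurable_gaussian k).aemeasurable).1 (hind k), hM.law_position k, hv k]
  have hpm : ∀ k, Measurable fun ω => (ξ k ω, g k ω) := fun k =>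
    (hM.measurable_position k).prodMk (hM.measurable_gaussian k)
  have key := ae_summable_rpow_mul (P := P) hp (Y := fun k ω => u (ξ k ω) * z (g k ω))
    (fun k => hF.comp (hpm k)) (fun k ω => mul_nonneg (hu0 _) (hz0 _))
    (fun k => IdentDistrib.comp (u := fun q : Plane × ℝ => u q.1 * z q.2)
      ⟨(hpm k).aemeasurable, (hpm 0).aemeasurable, by rw [hlaw, hlaw]⟩ hF) ?_
  · filter_upwards [key, hM.ae_arrival_ge] with ω hω hΓ
    obtain ⟨c, hc, hck⟩ := hΓ
    refine Summable.of_norm_bounded_eventually_nat (hω.mul_left (c ^ (-p))) ?_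
    filter_upwards [hck] with k hk
    have hk0 : (0 : ℝ) < k + 1 := by positivity
    have hΓ0 : 0 < Γ k ω := lt_of_lt_of_le (mul_pos hc hk0) hk
    have hy : 0 ≤ u (ξ k ω) * z (g k ω) := mul_nonneg (hu0 _) (hz0 _)
    rw [Real.norm_of_nonneg (mul_nonneg (Real.rpow_nonneg hΓ0.le _) hy), ← mul_assoc (c ^ (-p)),
      ← Real.mul_rpow hc.le hk0.le]
    refine mul_le_mul_of_nonneg_right ?_ hy
    exact Real.rpow_le_rpow_of_nonpos (mul_pos hc hk0) hk (by linarith)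
  · have e1 : ∀ ω, ENNReal.ofReal ((u (ξ 0 ω) * z (g 0 ω)) ^ (1 / p)) =
        ENNReal.ofReal (u (ξ 0 ω) ^ (1 / p)) * ENNReal.ofReal (z (g 0 ω) ^ (1 / p)) := by
      intro ω
      rw [Real.mul_rpow (hu0 _) (hz0 _), ENNReal.ofReal_mul (Real.rpow_nonneg (hu0 _) _)]
    simp_rw [e1]
    have hum' : Measurable fun x => ENNReal.ofReal (u x ^ (1 / p)) := by fun_prop
    have hzm' : Measurable fun x => ENNReal.ofReal (z x ^ (1 / p)) := by fun_prop
    have hmul := lintegral_mul_eq_lintegral_mul_lintegral_of_indepFun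
      (hum'.comp (hM.measurable_position 0)) (hzm'.comp (hM.measurable_gaussian 0))
      ((hind 0).comp hum' hzm')
    simp only [Pi.mul_apply, Function.comp_def] at hmul
    rw [hmul]
    refine ENNReal.mul_ne_top ?_ hfin
    have e2 : ∫⁻ ω, ENNReal.ofReal (u (ξ 0 ω) ^ (1 / p)) ∂P =
        ∫⁻ x, ENNReal.ofReal (u x ^ (1 / p)) ∂P.map (ξ 0) :=
      (lintegral_map hum' (hM.measurable_position 0)).symm
    rw [e2, hM.law_position 0, lintegral_withDensity_eq_lintegral_mul _
      hφm.ennreal_ofReal hum']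
    -- The power 1/p turns φ ^ (-p) into φ ^ (-1), which cancels the density of the positions; the
    -- moment is the area of the ball.
    have e3 : ∀ x, ((fun x => ENNReal.ofReal (φ x)) * fun x => ENNReal.ofReal (u x ^ (1 / p))) x =
        (Metric.closedBall (0 : Plane) R).indicator (fun _ => 1) x := by
      intro x
      simp only [Pi.mul_apply, hu]
      by_cases hx : x ∈ Metric.closedBall (0 : Plane) R
      · have hφ0 := hM.density_pos x
        rw [Set.indicator_of_mem hx, Set.indicator_of_mem hx, mul_one, ← Real.rpow_mul hφ0.le,
          ← ENNReal.ofReal_mul hφ0.le]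
        have : -p * (1 / p) = -1 := by field_simp
        rw [this, Real.rpow_neg_one, mul_inv_cancel₀ hφ0.ne', ENNReal.ofReal_one]
      · rw [Set.indicator_of_notMem hx, Set.indicator_of_notMem hx, mul_zero,
          Real.zero_rpow (by positivity), ENNReal.ofReal_zero, mul_zero]
    simp_rw [e3]
    rw [lintegral_indicator measurableSet_closedBall]
    rw [setLIntegral_one]
    exact measure_closedBall_lt_top.ne

end LePageSystem

/-! ### Convergence of Gaussian series. -/

section Kolmogorov

variable {Ω : Type*} [MeasurableSpace Ω] {P : Measure Ω} {g : ℕ → Ω → ℝ} {v : NNReal}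

lemma memLp_two_of_map_eq {X : Ω → ℝ} (hX : Measurable X) (h : P.map X = gaussianReal 0 v) :
    MemLp X 2 P := by
  have h1 : MemLp id 2 (P.map X) := by rw [h]; exact memLp_id_gaussianReal' 2 (by norm_num)
  exact (memLp_map_measure_iff aestronglyMeasurable_id hX.aemeasurable).1 h1

lemma integral_eq_zero_of_map_eq {X : Ω → ℝ} (hX : Measurable X)
    (h : P.map X = gaussianReal 0 v) : ∫ ω, X ω ∂P = 0 := by
  have h1 : ∫ x, x ∂P.map X = ∫ ω, X ω ∂P :=
    integral_map hX.aemeasurable aestronglyMeasurable_id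
  rw [← h1, h, integral_id_gaussianReal]

lemma variance_of_map_eq {X : Ω → ℝ} (hX : Measurable X)
    (h : P.map X = gaussianReal 0 v) : Var[X; P] = v := by
  rw [← variance_id_map hX.aemeasurable, h, variance_id_gaussianReal]

variable [IsProbabilityMeasure P]

lemma integral_sum_mul_sq (hg : ∀ k, Measurable (g k)) (hind : iIndepFun g P)
    (hlaw : ∀ k, P.map (g k) = gaussianReal 0 v) (c : ℕ → ℝ) (s : Finset ℕ) :
    ∫ ω, (∑ k ∈ s, c k * g k ω) ^ 2 ∂P = v * ∑ k ∈ s, c k ^ 2 := by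
  have hL : ∀ k, MemLp (fun ω => c k * g k ω) 2 P := fun k =>
    (memLp_two_of_map_eq (hg k) (hlaw k)).const_mul (c k)
  have hm : AEMeasurable (fun ω => ∑ k ∈ s, c k * g k ω) P := by fun_prop
  have h0 : ∫ ω, ∑ k ∈ s, c k * g k ω ∂P = 0 := by
    rw [integral_finsetSum _ fun k _ => (hL k).integrable (by norm_num)]
    refine Finset.sum_eq_zero fun k _ => ?_
    rw [integral_const_mul, integral_eq_zero_of_map_eq (hg k) (hlaw k), mul_zero]
  rw [← variance_of_integral_eq_zero hm h0]
  have hsum := IndepFun.variance_sum (μ := P) (X := fun k ω => c k * g k ω) (s := s)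
    (fun k _ => hL k)
    (fun i _ j _ hij => (hind.indepFun hij).comp (measurable_const_mul (c i))
      (measurable_const_mul (c j)))
  have e : (∑ k ∈ s, fun ω => c k * g k ω) = fun ω => ∑ k ∈ s, c k * g k ω := by
    ext ω; simp
  rw [e] at hsum
  rw [hsum, Finset.mul_sum]
  refine Finset.sum_congr rfl fun k _ => ?_
  rw [variance_const_mul, variance_of_map_eq (hg k) (hlaw k), mul_comm]

lemma lintegral_sum_mul_sq (hg : ∀ k, Measurable (g k)) (hind : iIndepFun g P)
    (hlaw : ∀ k, P.map (g k) = gaussianReal 0 v) (c : ℕ → ℝ) (s : Finset ℕ) :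
    ∫⁻ ω, ‖∑ k ∈ s, c k * g k ω‖ₑ ^ 2 ∂P = v * ∑ k ∈ s, ‖c k‖ₑ ^ 2 := by
  have hL : MemLp (fun ω => ∑ k ∈ s, c k * g k ω) 2 P :=
    memLp_finsetSum _ fun k _ => (memLp_two_of_map_eq (hg k) (hlaw k)).const_mul (c k)
  have hsq : ∀ x : ℝ, ‖x‖ₑ ^ 2 = ENNReal.ofReal (x ^ 2) := by
    intro x
    rw [Real.enorm_eq_ofReal_abs, ← ENNReal.ofReal_pow (abs_nonneg x), sq_abs]
  simp_rw [hsq]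
  rw [← ofReal_integral_eq_lintegral_ofReal hL.integrable_sq
    (Eventually.of_forall fun ω => sq_nonneg _), integral_sum_mul_sq hg hind hlaw,
    ENNReal.ofReal_mul (NNReal.coe_nonneg v), ENNReal.ofReal_sum_of_nonneg fun k _ => sq_nonneg _]
  congr 1
  exact ENNReal.ofReal_coe_nnreal

/-- Kolmogorov's one-series theorem for Gaussian variables. -/
lemma ae_exists_tendsto_sum_mul (hg : ∀ k, Measurable (g k)) (hind : iIndepFun g P)
    (hlaw : ∀ k, P.map (g k) = gaussianReal 0 v) {c : ℕ → ℝ}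
    (hc : ∑' k, ‖c k‖ₑ ^ 2 ≠ ⊤) :
    ∀ᵐ ω ∂P, ∃ l, Tendsto (fun N => ∑ k ∈ Finset.range N, c k * g k ω) atTop (𝓝 l) := by
  have hsm : ∀ k, StronglyMeasurable (g k) := fun k => (hg k).stronglyMeasurable
  set ℱ := Filtration.natural g hsm with hℱ
  have hLk : ∀ k, MemLp (fun ω => c k * g k ω) 2 P := fun k =>
    (memLp_two_of_map_eq (hg k) (hlaw k)).const_mul (c k)
  -- The shift by one makes `f n` involve `g 0, …, g n`, exactly the variables that generate `ℱ n`.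
  set f : ℕ → Ω → ℝ := fun n ω => ∑ k ∈ Finset.range (n + 1), c k * g k ω with hf
  have hL : ∀ n, MemLp (f n) 2 P := fun n => memLp_finsetSum _ fun k _ => hLk k
  have hint : ∀ n, Integrable (f n) P := fun n => (hL n).integrable (by norm_num)
  have hadg : ∀ i k, k ≤ i → StronglyMeasurable[ℱ i] (g k) := fun i k hk =>
    (Filtration.stronglyAdapted_natural hsm k).mono (ℱ.mono hk)
  have hadp : StronglyAdapted ℱ f := by
    intro n
    refine Finset.stronglyMeasurable_fun_sum _ fun k hk => ?_
    exact (hadg n k (Nat.lt_succ_iff.1 (Finset.mem_range.1 hk))).const_mul (c k)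
  have hmart : Martingale f ℱ P := by
    refine martingale_nat hadp hint fun i => ?_
    have e : f (i + 1) = f i + c (i + 1) • g (i + 1) := by
      ext ω
      simp only [hf, Pi.add_apply, Pi.smul_apply, smul_eq_mul]
      rw [Finset.sum_range_succ _ (i + 1)]
    have hgi : Integrable (g (i + 1)) P :=
      (memLp_two_of_map_eq (hg (i + 1)) (hlaw (i + 1))).integrable (by norm_num)
    have h1 := condExp_add (m := ℱ i) (hint i) (hgi.smul (c (i + 1)))
    have h2 := condExp_smul (μ := P) (c (i + 1)) (g (i + 1)) (ℱ i)
    have h3 := iIndepFun.condExp_natural_ae_eq_of_lt hsm hind (Nat.lt_succ_self i)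
    rw [e]
    filter_upwards [h1, h2, h3] with ω h1 h2 h3
    have h4 : (P[f i | ℱ i]) = f i := condExp_of_stronglyMeasurable (ℱ.le i) (hadp i) (hint i)
    rw [h1, Pi.add_apply, h2, Pi.smul_apply, h3, h4,
      integral_eq_zero_of_map_eq (hg (i + 1)) (hlaw (i + 1)), smul_zero, add_zero]
  -- On a probability space the L² bound from orthogonality controls the L¹ norm required by the
  -- martingale convergence theorem.
  have hbound : ∀ n, eLpNorm (f n) 1 P ≤
      ((((v : ENNReal) * ∑' k, ‖c k‖ₑ ^ 2) ^ (1 / 2 : ℝ)).toNNReal : ENNReal) := by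
    intro n
    have hfin : ((v : ENNReal) * ∑' k, ‖c k‖ₑ ^ 2) ^ (1 / 2 : ℝ) ≠ ⊤ :=
      ENNReal.rpow_ne_top_of_nonneg (by norm_num) (ENNReal.mul_ne_top (by simp) hc)
    rw [ENNReal.coe_toNNReal hfin]
    refine (eLpNorm_le_eLpNorm_of_exponent_le one_le_two (hL n).1).trans ?_
    rw [eLpNorm_eq_lintegral_rpow_enorm_toReal two_ne_zero (by norm_num)]
    simp only [ENNReal.toReal_ofNat]
    refine ENNReal.rpow_le_rpow ?_ (by norm_num)
    have h2 : ∀ ω, ‖f n ω‖ₑ ^ (2 : ℝ) = ‖∑ k ∈ Finset.range (n + 1), c k * g k ω‖ₑ ^ 2 :=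
      fun ω => ENNReal.rpow_two _
    simp_rw [h2]
    rw [lintegral_sum_mul_sq hg hind hlaw]
    gcongr
    exact ENNReal.sum_le_tsum _
  filter_upwards [hmart.submartingale.ae_tendsto_limitProcess hbound] with ω hω
  exact ⟨_, (tendsto_add_atTop_iff_nat 1).1 hω⟩

end Kolmogorov

/-! ### Termwise integration of series of functions. -/

section SumsAgainst

variable {E : Type*} [MeasurableSpace E]

/-- The series of functions `∑ k, h k` converges almost everywhere, and may be integrated against
`ψ` term by term. -/
structure SumsAgainst (ν : Measure E) (h : ℕ → E → ℝ) (ψ : E → ℝ) : Prop where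
  converges : ∀ᵐ e ∂ν, ∃ l, Tendsto (fun N => ∑ k ∈ Finset.range N, h k e) atTop (𝓝 l)
  integrable : Integrable
    (fun e => limUnder atTop (fun N => ∑ k ∈ Finset.range N, h k e) * ψ e) ν
  tendsto : Tendsto (fun N => ∑ k ∈ Finset.range N, ∫ e, h k e * ψ e ∂ν) atTop
    (𝓝 (∫ e, limUnder atTop (fun N => ∑ k ∈ Finset.range N, h k e) * ψ e ∂ν))

/-- The absolute case: by Tonelli the sum of |h k| is integrable, hence finite almost everywhere,
and a bounded `ψ` preserves this. -/
lemma sumsAgainst_of_tsum_lintegral_ne_top {ν : Measure E} {h : ℕ → E → ℝ} {ψ : E → ℝ}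
    (hh : ∀ k, AEStronglyMeasurable (h k) ν) (hψ : AEStronglyMeasurable ψ ν) {C : ℝ}
    (hC : ∀ᵐ e ∂ν, |ψ e| ≤ C) (hfin : ∑' k, ∫⁻ e, ‖h k e‖ₑ ∂ν ≠ ⊤) : SumsAgainst ν h ψ := by
  have hae : ∀ᵐ e ∂ν, ∑' k, ‖h k e‖ₑ < ⊤ := by
    refine ae_lt_top' (AEMeasurable.tsum fun k => (hh k).enorm) ?_
    rwa [lintegral_tsum fun k => (hh k).enorm]
  have hsum : ∀ᵐ e ∂ν, Summable fun k => h k e := by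
    filter_upwards [hae] with e he
    refine Summable.of_norm ?_
    have := ENNReal.summable_toReal he.ne
    simpa using this
  have hlim : ∀ᵐ e ∂ν, Tendsto (fun N => ∑ k ∈ Finset.range N, h k e) atTop (𝓝 (∑' k, h k e)) := by
    filter_upwards [hsum] with e he
    exact he.hasSum.tendsto_sum_nat
  have hint : ∀ k, Integrable (fun e => h k e * ψ e) ν := by
    intro k
    have hk : Integrable (h k) ν :=
      ⟨hh k, lt_of_le_of_lt (ENNReal.le_tsum k) hfin.lt_top⟩
    exact hk.mul_bdd (c := C) hψ hC
  have hnorm : Summable fun k => ∫ e, ‖h k e * ψ e‖ ∂ν := by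
    have h1 : ∀ k, ∫ e, ‖h k e * ψ e‖ ∂ν ≤ |C| * (∫⁻ e, ‖h k e‖ₑ ∂ν).toReal := by
      intro k
      rw [← integral_norm_eq_lintegral_enorm (hh k), ← integral_const_mul]
      refine integral_mono_ae (hint k).norm ?_ ?_
      · refine Integrable.const_mul (Integrable.norm ⟨hh k, ?_⟩) _
        exact lt_of_le_of_lt (ENNReal.le_tsum k) hfin.lt_top
      · filter_upwards [hC] with e he
        rw [norm_mul, mul_comm]
        exact mul_le_mul_of_nonneg_right (he.trans (le_abs_self C)) (norm_nonneg _)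
    refine Summable.of_nonneg_of_le (fun k => integral_nonneg fun e => norm_nonneg _) h1 ?_
    exact (ENNReal.summable_toReal hfin).mul_left _
  have hcongr : (fun e => limUnder atTop (fun N => ∑ k ∈ Finset.range N, h k e) * ψ e) =ᵐ[ν]
      fun e => ∑' k, h k e * ψ e := by
    filter_upwards [hlim] with e he
    rw [he.limUnder_eq, tsum_mul_right]
  refine ⟨?_, ?_, ?_⟩
  · filter_upwards [hlim] with e he using ⟨_, he⟩
  · refine Integrable.congr ?_ hcongr.symm
    refine ⟨?_, ?_⟩
    · refine aestronglyMeasurable_of_tendsto_ae atTop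
        (f := fun N e => ∑ k ∈ Finset.range N, h k e * ψ e) (fun N => ?_) ?_
      · exact Finset.aestronglyMeasurable_fun_sum _ fun k _ => (hint k).1
      · filter_upwards [hsum] with e he
        exact (he.mul_right (ψ e)).hasSum.tendsto_sum_nat
    · have h2 : ∫⁻ e, ∑' k, ‖h k e * ψ e‖ₑ ∂ν < ⊤ := by
        rw [lintegral_tsum fun k => (hint k).1.enorm]
        have : ∀ k, ∫⁻ e, ‖h k e * ψ e‖ₑ ∂ν = ENNReal.ofReal (∫ e, ‖h k e * ψ e‖ ∂ν) := by
          intro k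
          rw [ofReal_integral_norm_eq_lintegral_enorm (hint k)]
        simp_rw [this]
        rw [← ENNReal.ofReal_tsum_of_nonneg (fun k => integral_nonneg fun e => norm_nonneg _) hnorm]
        exact ENNReal.ofReal_lt_top
      exact lt_of_le_of_lt (lintegral_mono fun e => enorm_tsum_le_tsum_enorm) h2
  · rw [integral_congr_ae hcongr]
    exact (hasSum_integral_of_summable_integral_norm hint hnorm).tendsto_sum_nat

lemma enorm_integral_mul_sq_le {ν : Measure E} {f ψ : E → ℝ} (hf : AEStronglyMeasurable f ν)
    (hψ : AEStronglyMeasurable ψ ν) :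
    ‖∫ e, f e * ψ e ∂ν‖ₑ ^ 2 ≤ (∫⁻ e, ‖f e‖ₑ ^ 2 ∂ν) * ∫⁻ e, ‖ψ e‖ₑ ^ 2 ∂ν := by
  have h1 := ENNReal.lintegral_mul_le_Lp_mul_Lq ν (p := 2) (q := 2)
    (Real.holderConjugate_iff.2 ⟨by norm_num, by norm_num⟩) hf.enorm hψ.enorm
  simp only [Pi.mul_apply, ENNReal.rpow_two] at h1
  have h2 : ‖∫ e, f e * ψ e ∂ν‖ₑ ≤ ∫⁻ e, ‖f e‖ₑ * ‖ψ e‖ₑ ∂ν := by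
    refine (enorm_integral_le_lintegral_enorm _).trans (le_of_eq ?_)
    simp_rw [enorm_mul]
  have h3 := pow_le_pow_left' (h2.trans h1) 2
  have h4 : ∀ x : ENNReal, (x ^ (1 / 2 : ℝ)) ^ 2 = x := by
    intro x
    rw [← ENNReal.rpow_natCast, ← ENNReal.rpow_mul]
    norm_num
  rwa [mul_pow, h4, h4] at h3

/-- For a measurable family of series, the set of parameters at which the series may be summed
against `ψ` is measurable. -/
lemma measurableSet_sumsAgainst {β : Type*} [MeasurableSpace β] {ν : Measure E} [SFinite ν]
    {h : ℕ → β → E → ℝ} (hh : ∀ k, Measurable (Function.uncurry (h k))) {ψ : E → ℝ}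
    (hψ : Measurable ψ) : MeasurableSet {b | SumsAgainst ν (fun k => h k b) ψ} := by
  have hS : ∀ N, Measurable fun q : β × E => ∑ k ∈ Finset.range N, h k q.1 q.2 := fun N =>
    Finset.measurable_fun_sum _ fun k _ => hh k
  have hL : StronglyMeasurable fun q : β × E =>
      limUnder atTop (fun N => ∑ k ∈ Finset.range N, h k q.1 q.2) :=
    StronglyMeasurable.limUnder fun N => (hS N).stronglyMeasurable
  have hLψ : StronglyMeasurable fun q : β × E =>
      limUnder atTop (fun N => ∑ k ∈ Finset.range N, h k q.1 q.2) * ψ q.2 :=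
    hL.mul (hψ.comp measurable_snd).stronglyMeasurable
  have m1 : MeasurableSet {b | ∀ᵐ e ∂ν, ∃ l, Tendsto
      (fun N => ∑ k ∈ Finset.range N, h k b e) atTop (𝓝 l)} := by
    have hc : MeasurableSet {q : β × E | ∃ l, Tendsto
        (fun N => ∑ k ∈ Finset.range N, h k q.1 q.2) atTop (𝓝 l)} :=
      measurableSet_exists_tendsto hS
    exact measurable_measure_prodMk_left hc.compl (measurableSet_singleton 0)
  have m2 := measurableSet_integrable (μ := ν) (f := fun b e =>
      limUnder atTop (fun N => ∑ k ∈ Finset.range N, h k b e) * ψ e) hLψ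
  have m3 : MeasurableSet {b | Tendsto (fun N => ∑ k ∈ Finset.range N, ∫ e, h k b e * ψ e ∂ν) atTop
      (𝓝 (∫ e, limUnder atTop (fun N => ∑ k ∈ Finset.range N, h k b e) * ψ e ∂ν))} := by
    refine measurableSet_tendsto_fun (fun N => ?_) ?_
    · refine Finset.measurable_fun_sum _ fun k _ => ?_
      exact (StronglyMeasurable.integral_prod_right' (f := fun q : β × E => h k q.1 q.2 * ψ q.2)
        ((hh k).mul (hψ.comp measurable_snd)).stronglyMeasurable).measurable
    · exact (StronglyMeasurable.integral_prod_right' hLψ).measurable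
  convert m1.inter (m2.inter m3) using 1
  ext b
  exact ⟨fun hb => ⟨hb.1, hb.2, hb.3⟩, fun hb => ⟨hb.1, hb.2.1, hb.2.2⟩⟩

lemma ae_prod_tendsto_limUnder {Ω : Type*} [MeasurableSpace Ω] {P : Measure Ω}
    [SFinite P] {ν : Measure E} [SFinite ν] {S : ℕ → Ω × E → ℝ}
    (hS : ∀ N, Measurable (S N))
    (h : ∀ᵐ ω ∂P, ∀ᵐ e ∂ν, ∃ l, Tendsto (fun N => S N (ω, e)) atTop (𝓝 l)) :
    ∀ᵐ q ∂P.prod ν, Tendsto (fun N => S N q) atTop (𝓝 (limUnder atTop fun N => S N q)) := by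
  have : ∀ᵐ q ∂P.prod ν, ∃ l, Tendsto (fun N => S N q) atTop (𝓝 l) :=
    (Measure.ae_prod_iff_ae_ae (p := fun q => ∃ l, Tendsto (fun N => S N q) atTop (𝓝 l))
      (measurableSet_exists_tendsto hS)).2 h
  filter_upwards [this] with q hq
  exact tendsto_nhds_limUnder hq

variable {Ω : Type*} [MeasurableSpace Ω] {P : Measure Ω} [IsProbabilityMeasure P] {g : ℕ → Ω → ℝ}
  {v : NNReal}

lemma ae_ae_exists_tendsto_comm {ν : Measure E} [SFinite ν] {S : ℕ → Ω × E → ℝ}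
    (hS : ∀ N, Measurable (S N)) :
    (∀ᵐ ω ∂P, ∀ᵐ e ∂ν, ∃ l, Tendsto (fun N => S N (ω, e)) atTop (𝓝 l)) ↔
      ∀ᵐ e ∂ν, ∀ᵐ ω ∂P, ∃ l, Tendsto (fun N => S N (ω, e)) atTop (𝓝 l) :=
  Measure.ae_ae_comm (p := fun ω e => ∃ l, Tendsto (fun N => S N (ω, e)) atTop (𝓝 l))
    (measurableSet_exists_tendsto hS)

/-- A Gaussian series with square summable coefficient functions converges almost everywhere and
may be integrated term by term against square integrable functions. -/
lemma ae_sumsAgainst_gaussian (hg : ∀ k, Measurable (g k)) (hind : iIndepFun g P)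
    (hlaw : ∀ k, P.map (g k) = gaussianReal 0 v) {ν : Measure E} [SFinite ν] {h : ℕ → E → ℝ}
    (hh : ∀ k, Measurable (h k)) {ψ : E → ℝ} (hψ : Measurable ψ)
    (hψ2 : ∫⁻ e, ‖ψ e‖ₑ ^ 2 ∂ν ≠ ⊤) (hfin : ∑' k, ∫⁻ e, ‖h k e‖ₑ ^ 2 ∂ν ≠ ⊤) :
    ∀ᵐ ω ∂P, SumsAgainst ν (fun k e => h k e * g k ω) ψ := by
  obtain ⟨S, hSdef⟩ : ∃ S : ℕ → Ω × E → ℝ,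
      S = fun N q => ∑ k ∈ Finset.range N, h k q.2 * g k q.1 := ⟨_, rfl⟩
  have hSm : ∀ N, Measurable (S N) := fun N => by
    rw [hSdef]
    exact Finset.measurable_fun_sum _ fun k _ =>
      ((hh k).comp measurable_snd).mul ((hg k).comp measurable_fst)
  obtain ⟨L, hLdef⟩ : ∃ L : Ω × E → ℝ, L = fun q => limUnder atTop fun N => S N q := ⟨_, rfl⟩
  have hLm : Measurable L := by
    rw [hLdef]
    exact (StronglyMeasurable.limUnder fun N => (hSm N).stronglyMeasurable).measurable
  set t : ℕ → ENNReal := fun N => ∑' k, ∫⁻ e, ‖h (k + N) e‖ₑ ^ 2 ∂ν with ht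
  have ht0 : Tendsto t atTop (𝓝 0) := ENNReal.tendsto_sum_nat_add _ hfin
  -- almost everywhere convergence
  have hconv : ∀ᵐ ω ∂P, ∀ᵐ e ∂ν, ∃ l, Tendsto (fun N => S N (ω, e)) atTop (𝓝 l) := by
    rw [ae_ae_exists_tendsto_comm hSm, hSdef]
    have hae : ∀ᵐ e ∂ν, ∑' k, ‖h k e‖ₑ ^ 2 < ⊤ := by
      refine ae_lt_top (Measurable.tsum fun k => (hh k).enorm.pow_const 2) ?_
      rwa [lintegral_tsum fun k => ((hh k).enorm.pow_const 2).aemeasurable]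
    filter_upwards [hae] with e he
    exact ae_exists_tendsto_sum_mul hg hind hlaw he.ne
  have hconv' : ∀ᵐ q ∂P.prod ν, Tendsto (fun N => S N q) atTop (𝓝 (L q)) := by
    rw [hLdef]
    exact ae_prod_tendsto_limUnder hSm hconv
  -- mean square distance to the partial sums
  have hdist : ∀ N M, N ≤ M → ∫⁻ q, ‖S M q - S N q‖ₑ ^ 2 ∂P.prod ν ≤ v * t N := by
    intro N M hNM
    have e1 : ∀ q, S M q - S N q = ∑ k ∈ Finset.Ico N M, h k q.2 * g k q.1 := by
      intro q
      rw [Finset.sum_Ico_eq_sub _ hNM, hSdef]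
    simp_rw [e1]
    have hm : Measurable fun q : Ω × E => ‖∑ k ∈ Finset.Ico N M, h k q.2 * g k q.1‖ₑ ^ 2 :=
      (Finset.measurable_fun_sum _ fun k _ =>
        ((hh k).comp measurable_snd).mul ((hg k).comp measurable_fst)).enorm.pow_const 2
    rw [lintegral_prod_symm _ hm.aemeasurable]
    simp_rw [lintegral_sum_mul_sq hg hind hlaw (fun k => h k _)]
    rw [lintegral_const_mul _ (Finset.measurable_fun_sum _ fun k _ => (hh k).enorm.pow_const 2),
      lintegral_finsetSum _ fun k _ => (hh k).enorm.pow_const 2]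
    gcongr
    rw [Finset.sum_Ico_eq_sum_range]
    simp_rw [add_comm N]
    exact ENNReal.sum_le_tsum _
  -- Fatou's lemma carries the bound, uniform in `M`, over to the limit.
  have hdistL : ∀ N, ∫⁻ q, ‖L q - S N q‖ₑ ^ 2 ∂P.prod ν ≤ v * t N := by
    intro N
    calc ∫⁻ q, ‖L q - S N q‖ₑ ^ 2 ∂P.prod ν
        ≤ ∫⁻ q, liminf (fun M => ‖S M q - S N q‖ₑ ^ 2) atTop ∂P.prod ν := by
          refine lintegral_mono_ae ?_
          filter_upwards [hconv'] with q hq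
          have : Tendsto (fun M => ‖S M q - S N q‖ₑ ^ 2) atTop (𝓝 (‖L q - S N q‖ₑ ^ 2)) :=
            ((ENNReal.continuous_pow 2).tendsto _).comp ((hq.sub_const (S N q)).enorm)
          rw [this.liminf_eq]
      _ ≤ liminf (fun M => ∫⁻ q, ‖S M q - S N q‖ₑ ^ 2 ∂P.prod ν) atTop :=
          lintegral_liminf_le fun M => ((hSm M).sub (hSm N)).enorm.pow_const 2
      _ ≤ v * t N := by
          refine (liminf_le_liminf (eventually_atTop.2 ⟨N, fun M hM => hdist N M hM⟩)).trans ?_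
          simp
  -- square integrability of the limit
  have hL2 : ∀ᵐ ω ∂P, MemLp (fun e => L (ω, e)) 2 ν := by
    have h0 : ∫⁻ ω, ∫⁻ e, ‖L (ω, e)‖ₑ ^ 2 ∂ν ∂P ≠ ⊤ := by
      rw [← lintegral_prod _ (hLm.enorm.pow_const 2).aemeasurable]
      have h1 := hdistL 0
      simp only [hSdef, Finset.range_zero, Finset.sum_empty, sub_zero] at h1
      exact ne_top_of_le_ne_top (ENNReal.mul_ne_top (by simp) (by simpa [ht] using hfin)) h1
    filter_upwards [ae_lt_top' (hLm.enorm.pow_const 2).lintegral_prod_right'.aemeasurable h0]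
      with ω hω
    refine (memLp_two_iff_integrable_sq_norm
      (hLm.comp measurable_prodMk_left).aestronglyMeasurable).2 ⟨?_, ?_⟩
    · exact ((hLm.comp measurable_prodMk_left).norm.pow_const 2).aestronglyMeasurable
    · simpa [HasFiniteIntegral] using hω
  have hψL : MemLp ψ 2 ν := by
    refine (memLp_two_iff_integrable_sq_norm hψ.aestronglyMeasurable).2 ⟨?_, ?_⟩
    · exact (hψ.norm.pow_const 2).aestronglyMeasurable
    · simpa [HasFiniteIntegral] using hψ2.lt_top
  have hhL : ∀ k, MemLp (h k) 2 ν := fun k => by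
    refine (memLp_two_iff_integrable_sq_norm (hh k).aestronglyMeasurable).2 ⟨?_, ?_⟩
    · exact ((hh k).norm.pow_const 2).aestronglyMeasurable
    · have := lt_of_le_of_lt (ENNReal.le_tsum k) hfin.lt_top
      simpa [HasFiniteIntegral] using this
  -- convergence of the integrated series
  set c : ℕ → ℝ := fun k => ∫ e, h k e * ψ e ∂ν with hc
  have hcfin : ∑' k, ‖c k‖ₑ ^ 2 ≠ ⊤ := by
    refine ne_top_of_le_ne_top ?_ (ENNReal.tsum_le_tsum fun k =>
      enorm_integral_mul_sq_le (hh k).aestronglyMeasurable hψ.aestronglyMeasurable)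
    rw [ENNReal.tsum_mul_right]
    exact ENNReal.mul_ne_top hfin hψ2
  set I : Ω → ℝ := fun ω => ∫ e, L (ω, e) * ψ e ∂ν with hI
  have hIm : Measurable I :=
    (StronglyMeasurable.integral_prod_right' (f := fun q : Ω × E => L q * ψ q.2)
      (hLm.mul (hψ.comp measurable_snd)).stronglyMeasurable).measurable
  set Z : ℕ → Ω → ℝ := fun N ω => ∑ k ∈ Finset.range N, c k * g k ω with hZ
  have hZm : ∀ N, Measurable (Z N) := fun N => Finset.measurable_fun_sum _ fun k _ =>
    (hg k).const_mul (c k)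
  have hZS : ∀ N ω, Z N ω = ∫ e, S N (ω, e) * ψ e ∂ν := by
    intro N ω
    simp only [hZ, hSdef, Finset.sum_mul]
    rw [integral_finsetSum]
    · refine Finset.sum_congr rfl fun k _ => ?_
      rw [hc, ← integral_mul_const]
      refine integral_congr_ae (Eventually.of_forall fun e => ?_)
      simp only
      ring
    · intro k _
      have := ((hhL k).integrable_mul hψL).mul_const (g k ω)
      refine this.congr (Eventually.of_forall fun e => ?_)
      simp only [Pi.mul_apply]
      ring
  have hZI : ∀ N, ∫⁻ ω, ‖Z N ω - I ω‖ₑ ^ 2 ∂P ≤ v * t N * ∫⁻ e, ‖ψ e‖ₑ ^ 2 ∂ν := by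
    intro N
    calc ∫⁻ ω, ‖Z N ω - I ω‖ₑ ^ 2 ∂P
        ≤ ∫⁻ ω, (∫⁻ e, ‖L (ω, e) - S N (ω, e)‖ₑ ^ 2 ∂ν) * ∫⁻ e, ‖ψ e‖ₑ ^ 2 ∂ν ∂P := by
          refine lintegral_mono_ae ?_
          filter_upwards [hL2] with ω hω
          have hSi : Integrable (fun e => S N (ω, e) * ψ e) ν := by
            have : MemLp (fun e => S N (ω, e)) 2 ν := by
              rw [hSdef]
              exact memLp_finsetSum _ fun k _ => (hhL k).mul_const (g k ω)
            exact this.integrable_mul hψL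
          have hLi : Integrable (fun e => L (ω, e) * ψ e) ν := hω.integrable_mul hψL
          rw [hZS, hI, ← edist_eq_enorm_sub, edist_comm, edist_eq_enorm_sub,
            ← integral_sub hLi hSi]
          simp_rw [← sub_mul]
          exact enorm_integral_mul_sq_le
            ((hLm.sub (hSm N)).comp measurable_prodMk_left).aestronglyMeasurable
            hψ.aestronglyMeasurable
      _ = (∫⁻ q, ‖L q - S N q‖ₑ ^ 2 ∂P.prod ν) * ∫⁻ e, ‖ψ e‖ₑ ^ 2 ∂ν := by
          have hm : Measurable fun q => ‖L q - S N q‖ₑ ^ 2 :=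
            (hLm.sub (hSm N)).enorm.pow_const 2
          rw [lintegral_mul_const _ hm.lintegral_prod_right', lintegral_prod _ hm.aemeasurable]
      _ ≤ _ := by
          gcongr
          exact hdistL N
  -- Mean-square convergence yields through Fatou only a vanishing lower limit. The one-series
  -- theorem applied to `Z` supplies an actual limit, which this identifies as `I ω`.
  have hZ0 : ∀ᵐ ω ∂P, liminf (fun N => ‖Z N ω - I ω‖ₑ ^ 2) atTop = 0 := by
    have hm : ∀ N, Measurable fun ω => ‖Z N ω - I ω‖ₑ ^ 2 := fun N =>
      ((hZm N).sub hIm).enorm.pow_const 2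
    have hle : ∫⁻ ω, liminf (fun N => ‖Z N ω - I ω‖ₑ ^ 2) atTop ∂P ≤ 0 := by
      refine (lintegral_liminf_le hm).trans ?_
      refine (liminf_le_liminf (Eventually.of_forall hZI)).trans (le_of_eq ?_)
      have : Tendsto (fun N => v * t N * ∫⁻ e, ‖ψ e‖ₑ ^ 2 ∂ν) atTop (𝓝 0) := by
        have h1 := ENNReal.Tendsto.const_mul (a := (v : ENNReal)) ht0 (Or.inr (by simp))
        have h2 := ENNReal.Tendsto.mul_const h1 (Or.inr hψ2)
        simpa using h2
      exact this.liminf_eq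
    exact (lintegral_eq_zero_iff (Measurable.liminf hm)).1 (le_antisymm hle bot_le)
  have hZconv := ae_exists_tendsto_sum_mul hg hind hlaw hcfin
  filter_upwards [hconv, hL2, hZ0, hZconv] with ω h1 h2 h3 ⟨l, hl⟩
  have h6 := h2.integrable_mul hψL
  simp only [hLdef, hSdef] at h1 h6
  refine ⟨h1, h6, ?_⟩
  have e2 : ∀ N, ∑ k ∈ Finset.range N, ∫ e, h k e * g k ω * ψ e ∂ν = Z N ω := by
    intro N
    refine Finset.sum_congr rfl fun k _ => ?_
    rw [hc, ← integral_mul_const]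
    refine integral_congr_ae (Eventually.of_forall fun e => ?_)
    simp only
    ring
  simp_rw [e2]
  have h4 : Tendsto (fun N => ‖Z N ω - I ω‖ₑ ^ 2) atTop (𝓝 (‖l - I ω‖ₑ ^ 2)) :=
    ((ENNReal.continuous_pow 2).tendsto _).comp ((hl.sub_const (I ω)).enorm)
  rw [h4.liminf_eq] at h3
  have h5 : l = I ω := by simpa [sub_eq_zero] using h3
  rw [h5, hI] at hl
  simp only [hLdef, hSdef] at hl
  exact hl

end SumsAgainst

/-! ### Freezing one of two independent variables. -/

section Conditioning

variable {Ω β γ : Type*} [MeasurableSpace Ω] [MeasurableSpace β] [MeasurableSpace γ]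
  {P : Measure Ω} [IsProbabilityMeasure P]

/-- A measurable property of two independent variables may be checked by freezing the first. -/
lemma ae_of_indepFun {X : Ω → β} {Y : Ω → γ} (hX : Measurable X) (hY : Measurable Y)
    (hXY : IndepFun X Y P) {Q : Set (β × γ)} (hQ : MeasurableSet Q)
    (h : ∀ᵐ ω ∂P, ∀ᵐ ω' ∂P, (X ω, Y ω') ∈ Q) : ∀ᵐ ω ∂P, (X ω, Y ω) ∈ Q := by
  have hlaw := (indepFun_iff_map_prod_eq_prod_map_map hX.aemeasurable hY.aemeasurable).1 hXY
  have := Measure.isProbabilityMeasure_map (μ := P) hX.aemeasurable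
  have := Measure.isProbabilityMeasure_map (μ := P) hY.aemeasurable
  have hsec : ∀ x, MeasurableSet {y | (x, y) ∈ Q} := fun x => measurable_prodMk_left hQ
  have hset : MeasurableSet {x | ∀ᵐ y ∂P.map Y, (x, y) ∈ Q} :=
    measurable_measure_prodMk_left hQ.compl (measurableSet_singleton 0)
  have h2 : ∀ᵐ p ∂P.map (fun ω => (X ω, Y ω)), p ∈ Q := by
    rw [hlaw, Measure.ae_prod_iff_ae_ae (p := (· ∈ Q)) hQ, ae_map_iff hX.aemeasurable hset]
    filter_upwards [h] with ω hω
    exact (ae_map_iff hY.aemeasurable (hsec _)).2 hω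
  exact ae_of_ae_map (hX.prodMk hY).aemeasurable h2

end Conditioning

/-- Only the positions in the ball contribute, so summability of the weights localized there is
enough. -/
lemma tsum_enorm_mul_ne_top {r : ℕ → ℝ} {y : ℕ → Plane} {R : ℝ} {B : ENNReal} (hB : B ≠ ⊤)
    {F : Plane → ENNReal} (hF : ∀ y, F y ≤ (Metric.closedBall 0 R).indicator (fun _ => B) y)
    (hr : Summable fun k => r k * (Metric.closedBall 0 R).indicator (fun _ => (1 : ℝ)) (y k)) :
    ∑' k, ‖r k‖ₑ * F (y k) ≠ ⊤ := by
  have h1 : ∀ k, ‖r k‖ₑ * F (y k) ≤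
      ‖r k * (Metric.closedBall 0 R).indicator (fun _ => (1 : ℝ)) (y k)‖ₑ * B := by
    intro k
    refine (mul_le_mul_right (hF (y k)) _).trans ?_
    by_cases hy : y k ∈ Metric.closedBall (0 : Plane) R
    · rw [Set.indicator_of_mem hy, Set.indicator_of_mem hy, mul_one]
    · rw [Set.indicator_of_notMem hy, Set.indicator_of_notMem hy]
      simp
  refine ne_top_of_le_ne_top ?_ (ENNReal.tsum_le_tsum h1)
  rw [ENNReal.tsum_mul_right]
  refine ENNReal.mul_ne_top ?_ hB
  have h2 := hr.norm
  simp_rw [← ofReal_norm]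
  rw [← ENNReal.ofReal_tsum_of_nonneg (fun k => norm_nonneg _) h2]
  exact ENNReal.ofReal_ne_top

/-! ### LePage series of kernels, absolutely and conditionally convergent. -/

section Series

variable {Ω : Type*} [MeasurableSpace Ω] {P : Measure Ω} {α : ℝ}
  {φ : Plane → ℝ} {Γ : ℕ → Ω → ℝ} {ξ : ℕ → Ω → Plane} {g : ℕ → Ω → ℝ}
  {E : Type*} [MeasurableSpace E] {ν : Measure E}

/-- The LePage series of a family of functions with locally bounded first moments, where the
weights are locally summable. -/
lemma sumsAgainst_of_summable {b z : ℕ → ℝ} {y : ℕ → Plane}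
    (hw : ∀ R : ℕ, Summable fun k =>
      b k * z k * (Metric.closedBall 0 (R : ℝ)).indicator (fun _ => (1 : ℝ)) (y k))
    {K : Plane → E → ℝ} (hK : ∀ y, Measurable (K y)) {R : ℝ} {B : ENNReal} (hB : B ≠ ⊤)
    (hKB : ∀ y, ∫⁻ e, ‖K y e‖ₑ ∂ν ≤ (Metric.closedBall 0 R).indicator (fun _ => B) y)
    {ψ : E → ℝ} (hψ : Measurable ψ) {C : ℝ} (hC : ∀ e, |ψ e| ≤ C) :
    SumsAgainst ν (fun k e => b k * K (y k) e * z k) ψ := by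
  -- Integer radii suffice, so that a single null event can later cover them all.
  obtain ⟨m, hm⟩ := exists_nat_ge R
  have hKB' : ∀ y, ∫⁻ e, ‖K y e‖ₑ ∂ν ≤ (Metric.closedBall 0 (m : ℝ)).indicator (fun _ => B) y :=
    fun y => (hKB y).trans (Set.indicator_le_indicator_of_subset
      (Metric.closedBall_subset_closedBall hm) (fun _ => zero_le) y)
  refine sumsAgainst_of_tsum_lintegral_ne_top
    (fun k => (((hK (y k)).const_mul (b k)).mul_const (z k)).aestronglyMeasurable)
    hψ.aestronglyMeasurable (Eventually.of_forall hC) ?_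
  have h1 : ∀ k, ∫⁻ e, ‖b k * K (y k) e * z k‖ₑ ∂ν =
      ‖b k * z k‖ₑ * ∫⁻ e, ‖K (y k) e‖ₑ ∂ν := fun k => by
    rw [← lintegral_const_mul _ (hK (y k)).enorm]
    refine lintegral_congr fun e => ?_
    rw [← enorm_mul, mul_right_comm]
  simp_rw [h1]
  exact tsum_enorm_mul_ne_top (F := fun y => ∫⁻ e, ‖K y e‖ₑ ∂ν) hB hKB' (hw m)

/-- The joint law is a triple product of laws; reassociating it separates the Gaussian variables
from the pair that will be frozen. -/
lemma IsLePageSystem.indepFun_pair_gaussian [IsProbabilityMeasure P]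
    (hM : IsLePageSystem P α φ Γ ξ g) :
    IndepFun (fun ω => ((fun k => Γ k ω), (fun k => ξ k ω))) (fun ω k => g k ω) P := by
  have mΓ : Measurable fun ω k => Γ k ω := measurable_pi_lambda _ hM.measurable_arrival
  have mξ : Measurable fun ω k => ξ k ω := measurable_pi_lambda _ hM.measurable_position
  have mg : Measurable fun ω k => g k ω := measurable_pi_lambda _ hM.measurable_gaussian
  have h1 := (indepFun_iff_map_prod_eq_prod_map_map mΓ.aemeasurable
    (mξ.prodMk mg).aemeasurable).1 hM.indep_arrival
  have h2 := (indepFun_iff_map_prod_eq_prod_map_map mξ.aemeasurable mg.aemeasurable).1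
    hM.indep_position_gaussian
  have h3 : IndepFun (fun ω k => Γ k ω) (fun ω k => ξ k ω) P :=
    hM.indep_arrival.comp measurable_id measurable_fst
  have h4 := (indepFun_iff_map_prod_eq_prod_map_map mΓ.aemeasurable mξ.aemeasurable).1 h3
  have := Measure.isProbabilityMeasure_map (μ := P) mΓ.aemeasurable
  have := Measure.isProbabilityMeasure_map (μ := P) mξ.aemeasurable
  have := Measure.isProbabilityMeasure_map (μ := P) mg.aemeasurable
  rw [indepFun_iff_map_prod_eq_prod_map_map (mΓ.prodMk mξ).aemeasurable mg.aemeasurable, h4]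
  rw [h2] at h1
  have h5 := (measurePreserving_prodAssoc (P.map fun ω k => Γ k ω) (P.map fun ω k => ξ k ω)
    (P.map fun ω k => g k ω)).symm
  rw [← h5.map_eq, ← h1, Measure.map_map h5.measurable (mΓ.prodMk (mξ.prodMk mg))]
  rfl

/-- The LePage series of a family of functions with locally bounded second moments. -/
lemma IsLePageSystem.ae_sumsAgainst [IsProbabilityMeasure P] [SFinite ν]
    (hM : IsLePageSystem P α φ Γ ξ g) (hα : 0 < α) (hα2 : α < 2)
    {K : Plane → E → ℝ} (hK : Measurable (Function.uncurry K)) {R : ℝ} {B : ENNReal} (hB : B ≠ ⊤)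
    (hKB : ∀ y, ∫⁻ e, ‖K y e‖ₑ ^ 2 ∂ν ≤ (Metric.closedBall 0 R).indicator (fun _ => B) y)
    {ψ : E → ℝ} (hψ : Measurable ψ) (hψ2 : ∫⁻ e, ‖ψ e‖ₑ ^ 2 ∂ν ≠ ⊤) :
    ∀ᵐ ω ∂P, SumsAgainst ν
      (fun k e => Γ k ω ^ (-1 / α) * φ (ξ k ω) ^ (-1 / α) * K (ξ k ω) e * g k ω) ψ := by
  obtain ⟨v, hv⟩ := hM.exists_gaussian_law hα
  have mX : Measurable fun ω => ((fun k => Γ k ω), (fun k => ξ k ω)) :=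
    (measurable_pi_lambda _ hM.measurable_arrival).prodMk
      (measurable_pi_lambda _ hM.measurable_position)
  have mg : Measurable fun ω k => g k ω := measurable_pi_lambda _ hM.measurable_gaussian
  have hφm : Measurable φ := hM.continuous_density.measurable
  let H : ℕ → ((ℕ → ℝ) × (ℕ → Plane)) × (ℕ → ℝ) → E → ℝ := fun k q e =>
    q.1.1 k ^ (-1 / α) * φ (q.1.2 k) ^ (-1 / α) * K (q.1.2 k) e * q.2 k
  have hH : ∀ k, Measurable (Function.uncurry (H k)) := by
    intro k
    have m1 : Measurable fun r : (((ℕ → ℝ) × (ℕ → Plane)) × (ℕ → ℝ)) × E => r.1.1.1 k := by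
      fun_prop
    have m2 : Measurable fun r : (((ℕ → ℝ) × (ℕ → Plane)) × (ℕ → ℝ)) × E => r.1.1.2 k := by
      fun_prop
    have m3 : Measurable fun r : (((ℕ → ℝ) × (ℕ → Plane)) × (ℕ → ℝ)) × E => r.1.2 k := by
      fun_prop
    exact (((m1.pow_const _).mul ((hφm.comp m2).pow_const _)).mul
      (hK.comp (m2.prodMk measurable_snd))).mul m3
  have hQ := measurableSet_sumsAgainst (ν := ν) hH hψ
  refine ae_of_indepFun mX mg hM.indepFun_pair_gaussian hQ ?_
  have hp : 1 < 2 / α := (one_lt_div hα).2 hα2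
  -- The exponent 2/α is that of the squared weights. The Gaussian variables are left out here
  -- because they remain random after the freezing.
  have hs := hM.ae_summable_weights hα hp (z := fun _ => 1) measurable_const
    (fun _ => zero_le_one) (by simp) R
  filter_upwards [hs, hM.ae_arrival_pos] with ω hω hΓ
  refine ae_sumsAgainst_gaussian hM.measurable_gaussian hM.indep_gaussian hv
    (h := fun k e => Γ k ω ^ (-1 / α) * φ (ξ k ω) ^ (-1 / α) * K (ξ k ω) e) (fun k => ?_) hψ hψ2 ?_
  · exact (hK.comp measurable_prodMk_left).const_mul _
  · have hKm : ∀ y, Measurable fun e => ‖K y e‖ₑ ^ 2 := fun y =>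
      (hK.comp measurable_prodMk_left).enorm.pow_const 2
    have hsq : ∀ x : ℝ, 0 < x → (x ^ (-1 / α)) ^ 2 = x ^ (-(2 / α)) := by
      intro x hx
      rw [← Real.rpow_natCast (x ^ _), ← Real.rpow_mul hx.le]
      congr 1
      push_cast
      ring
    have h1 : ∀ k, ∫⁻ e, ‖Γ k ω ^ (-1 / α) * φ (ξ k ω) ^ (-1 / α) * K (ξ k ω) e‖ₑ ^ 2 ∂ν =
        ‖Γ k ω ^ (-(2 / α)) * φ (ξ k ω) ^ (-(2 / α))‖ₑ * ∫⁻ e, ‖K (ξ k ω) e‖ₑ ^ 2 ∂ν := by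
      intro k
      rw [← lintegral_const_mul _ (hKm _)]
      refine lintegral_congr fun e => ?_
      rw [← hsq _ (hΓ k), ← hsq _ (hM.density_pos _)]
      simp only [enorm_mul, enorm_pow, mul_pow]
    simp_rw [h1]
    refine tsum_enorm_mul_ne_top (F := fun y => ∫⁻ e, ‖K y e‖ₑ ^ 2 ∂ν) hB hKB (hω.congr fun k => ?_)
    ring

end Series

/-! ### The source term and the wave operator as functions on all of space-time. -/

section Source

variable {σ θ : Plane → ℝ → ℝ}

lemma IsTestFunction.continuous_source (hθ : IsTestFunction θ)
    (hσ : ContinuousOn (Function.uncurry σ) (Set.univ ×ˢ Set.Ici (0 : ℝ))) :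
    Continuous (Function.uncurry fun (y : Plane) (t : ℝ) => θ y (max t 0) * σ y (max t 0)) :=
  (continuous_extend_const hθ.smooth.continuousOn).mul (continuous_extend_const hσ)

lemma IsTestFunction.lintegral_source_pow_le (hθ : IsTestFunction θ)
    (hS1 : ∃ C : ℝ, ∀ x t, 0 ≤ t → |σ x t| ≤ C) (n : ℝ) (k : ℕ) (hk : k ≠ 0) :
    ∃ (R : ℕ) (B : ENNReal), B ≠ ⊤ ∧ ∀ y, ∫⁻ t in Set.Ioo 0 n,
      ‖θ y (max t 0) * σ y (max t 0)‖ₑ ^ k ≤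
        (Metric.closedBall 0 (R : ℝ)).indicator (fun _ => B) y := by
  obtain ⟨C, hC⟩ := hS1
  -- Only the bounds on `θ` itself are kept, so the speed 1 is immaterial.
  obtain ⟨D, R, hD0, hR0, hD, -, hsupp, -⟩ := hθ.exists_bound 1
  obtain ⟨m, hm⟩ := exists_nat_ge R
  refine ⟨m, (ENNReal.ofReal D * ENNReal.ofReal C) ^ k * ENNReal.ofReal n, by finiteness,
    fun y => ?_⟩
  by_cases hy : y ∈ Metric.closedBall (0 : Plane) m
  · rw [Set.indicator_of_mem hy]
    calc ∫⁻ t in Set.Ioo 0 n, ‖θ y (max t 0) * σ y (max t 0)‖ₑ ^ k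
        ≤ ∫⁻ _ in Set.Ioo 0 n, (ENNReal.ofReal D * ENNReal.ofReal C) ^ k := by
          refine lintegral_mono fun t => ?_
          simp only
          rw [enorm_mul, Real.enorm_eq_ofReal_abs, Real.enorm_eq_ofReal_abs]
          gcongr
          · exact hD _ _ (le_max_right _ _)
          · exact hC _ _ (le_max_right _ _)
      _ = _ := by simp
  · rw [Set.indicator_of_notMem hy]
    refine le_of_eq ?_
    have h0 : ∀ t, θ y (max t 0) = 0 := fun t => hsupp _ _ (le_max_right _ _) fun h => hy (by
      rw [mem_closedBall_zero_iff]
      exact h.1.trans hm)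
    simp [h0, hk]

/-- The wave operator of a test function, extended by zero to nonpositive times. -/
def positiveWave (a : ℝ) (θ : Plane → ℝ → ℝ) (p : Plane × ℝ) : ℝ :=
  (Set.univ ×ˢ Set.Ioi (0 : ℝ)).indicator (fun p : Plane × ℝ => waveOperator a θ p.1 p.2) p

lemma IsTestFunction.measurable_positiveWave (hθ : IsTestFunction θ) (a : ℝ) :
    Measurable (positiveWave a θ) := by
  have h := (hθ.continuousOn_waveOperator a).measurable_piecewise
    (continuousOn_const (c := (0 : ℝ))) (MeasurableSet.univ.prod measurableSet_Ioi)
  rwa [show (fun _ : Plane × ℝ => (0 : ℝ)) = 0 from rfl, Set.piecewise_eq_indicator] at h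

lemma positiveWave_of_pos (a : ℝ) (θ : Plane → ℝ → ℝ) {p : Plane × ℝ} (hp : 0 < p.2) :
    positiveWave a θ p = waveOperator a θ p.1 p.2 :=
  Set.indicator_of_mem (show p ∈ Set.univ ×ˢ Set.Ioi (0 : ℝ) from ⟨trivial, hp⟩) _

lemma IsTestFunction.exists_positiveWave_bound (hθ : IsTestFunction θ) (a : ℝ) :
    ∃ C, ∀ p, |positiveWave a θ p| ≤ C := by
  obtain ⟨D, R, hD0, -, -, hD, -, -⟩ := hθ.exists_bound a
  refine ⟨D, fun p => ?_⟩
  by_cases hp : 0 < p.2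
  · rw [positiveWave_of_pos a θ hp]
    exact hD _ _ hp
  · have : p ∉ (Set.univ : Set Plane) ×ˢ Set.Ioi (0 : ℝ) := fun h => hp h.2
    rw [positiveWave, Set.indicator_of_notMem this, abs_zero]
    exact hD0

end Source

/-! ### From termwise integration to the weak identity. -/

section WeakForm

variable {Ω : Type*} {α : ℝ} {φ : Plane → ℝ} {Γ : ℕ → Ω → ℝ} {ξ : ℕ → Ω → Plane} {g : ℕ → Ω → ℝ}
  {a : ℝ} {σ θ : Plane → ℝ → ℝ}

lemma iUnion_cylinder : ⋃ n : ℕ, cylinder n = Set.univ ×ˢ Set.Ioi (0 : ℝ) := by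
  ext p
  simp only [Set.mem_iUnion, cylinder, Set.mem_prod, mem_closedBall_zero_iff, Set.mem_Ioo,
    Set.mem_univ, true_and, Set.mem_Ioi]
  constructor
  · rintro ⟨n, -, h, -⟩
    exact h
  · intro h
    obtain ⟨n, hn⟩ := exists_nat_gt (max ‖p.1‖ p.2)
    exact ⟨n, ((le_max_left _ _).trans hn.le), h, (le_max_right _ _).trans_lt hn⟩

lemma iUnion_Ioo_zero_nat : ⋃ n : ℕ, Set.Ioo (0 : ℝ) n = Set.Ioi 0 := by
  ext t
  simp only [Set.mem_iUnion, Set.mem_Ioo, Set.mem_Ioi]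
  constructor
  · rintro ⟨n, h, -⟩
    exact h
  · intro h
    obtain ⟨n, hn⟩ := exists_nat_gt t
    exact ⟨n, h, hn⟩

/-- The weak identity follows from termwise integration of the two LePage series over bounded
regions. -/
theorem weakIdentity_of_sumsAgainst (ha : 0 < a)
    (hS1 : ∃ C : ℝ, ∀ x t, 0 ≤ t → |σ x t| ≤ C)
    (hS2 : ContinuousOn (Function.uncurry σ) (Set.univ ×ˢ Set.Ici (0 : ℝ)))
    (hθ : IsTestFunction θ) {ω : Ω}
    (h1 : ∀ n : ℕ, SumsAgainst (volume.restrict (cylinder n)) (fun k p =>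
      Γ k ω ^ (-1 / α) * φ (ξ k ω) ^ (-1 / α) * poissonKernel a σ p.1 (ξ k ω) p.2 * g k ω)
      (positiveWave a θ))
    (h2 : ∀ n : ℕ, SumsAgainst (volume.restrict (Set.Ioo (0 : ℝ) n)) (fun k t =>
      Γ k ω ^ (-1 / α) * φ (ξ k ω) ^ (-1 / α) *
        (θ (ξ k ω) (max t 0) * σ (ξ k ω) (max t 0)) * g k ω) (fun _ => 1)) :
    WeakIdentity α φ Γ ξ g a σ θ ω := by
  obtain ⟨D, R, -, -, -, -, hθ0, hW0⟩ := hθ.exists_bound a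
  -- A single cylinder of size `n` carries both integrals; the larger ones serve only for
  -- convergence almost everywhere on the half-space.
  obtain ⟨n, hn⟩ := exists_nat_ge R
  have hms : MeasurableSet ((Set.univ : Set Plane) ×ˢ Set.Ioi (0 : ℝ)) :=
    MeasurableSet.univ.prod measurableSet_Ioi
  have hcyl : cylinder n ⊆ Set.univ ×ˢ Set.Ioi (0 : ℝ) := by
    rw [← iUnion_cylinder]
    exact Set.subset_iUnion (fun n : ℕ => cylinder n) n
  have hWout : ∀ p ∈ ((Set.univ : Set Plane) ×ˢ Set.Ioi (0 : ℝ)) \ cylinder n,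
      waveOperator a θ p.1 p.2 = 0 := by
    rintro p ⟨⟨-, hp⟩, hpc⟩
    have hp' : 0 < p.2 := hp
    refine hW0 _ _ hp' fun h => hpc ⟨?_, hp', h.2.trans_le hn⟩
    rw [mem_closedBall_zero_iff]
    exact h.1.trans hn
  have hθout : ∀ y, ∀ t ∈ Set.Ioi (0 : ℝ) \ Set.Ioo (0 : ℝ) n, θ y t = 0 := by
    rintro y t ⟨ht, htn⟩
    have ht' : 0 < t := ht
    exact hθ0 _ _ ht'.le fun h => htn ⟨ht', h.2.trans_le hn⟩
  -- the source series at positive times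
  have hsrc : ∀ t : ℝ, 0 < t → lePagePartialSum α φ Γ ξ g (fun x => θ x t * σ x t) ω =
      fun N => ∑ k ∈ Finset.range N, Γ k ω ^ (-1 / α) * φ (ξ k ω) ^ (-1 / α) *
        (θ (ξ k ω) (max t 0) * σ (ξ k ω) (max t 0)) * g k ω := by
    intro t ht
    funext N
    rw [max_eq_left ht.le]
    rfl
  have hint : IntegrableOn
      (fun p : Plane × ℝ => candidate α φ Γ ξ g a σ p.1 p.2 ω * waveOperator a θ p.1 p.2)
      (Set.univ ×ˢ Set.Ioi (0 : ℝ)) := by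
    refine IntegrableOn.of_forall_sdiff_eq_zero (s := cylinder n) ?_ hms
      fun p hp => by rw [hWout p hp, mul_zero]
    refine IntegrableOn.congr_fun ((h1 n).integrable.const_mul (stableConst α)) (fun p hp => ?_)
      (measurableSet_cylinder n)
    rw [positiveWave_of_pos a θ (hcyl hp).2, ← mul_assoc]
    rfl
  have hcongr : ∀ t ∈ Set.Ioo (0 : ℝ) n, stableConst α * (limUnder atTop (fun N =>
      ∑ k ∈ Finset.range N, Γ k ω ^ (-1 / α) * φ (ξ k ω) ^ (-1 / α) *
        (θ (ξ k ω) (max t 0) * σ (ξ k ω) (max t 0)) * g k ω) * 1) =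
      stableIntegral α φ Γ ξ g (fun x => θ x t * σ x t) ω := by
    intro t ht
    rw [stableIntegral, hsrc t ht.1, mul_one]
  have hsrcout : ∀ t ∈ Set.Ioi (0 : ℝ) \ Set.Ioo (0 : ℝ) n,
      stableIntegral α φ Γ ξ g (fun x => θ x t * σ x t) ω = 0 := by
    intro t ht
    have : lePagePartialSum α φ Γ ξ g (fun x => θ x t * σ x t) ω = fun _ => 0 := by
      funext N
      simp [lePagePartialSum, hθout _ t ht]
    rw [stableIntegral, this, tendsto_const_nhds.limUnder_eq, mul_zero]
  refine ⟨?_, hint, ?_, ?_, ?_⟩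
  · rw [← iUnion_cylinder, ae_restrict_iUnion_iff]
    exact fun m => (h1 m).converges
  · rw [← iUnion_Ioo_zero_nat, ae_restrict_iUnion_iff]
    intro m
    filter_upwards [(h2 m).converges, ae_restrict_mem measurableSet_Ioo] with t ht htm
    rw [LePageConverges, hsrc t htm.1]
    exact ht
  · refine IntegrableOn.of_forall_sdiff_eq_zero (s := Set.Ioo (0 : ℝ) n) ?_
      measurableSet_Ioi hsrcout
    exact IntegrableOn.congr_fun ((h2 n).integrable.const_mul (stableConst α)) hcongr
      measurableSet_Ioo
  · have e1 : ∫ t in Set.Ioi (0 : ℝ), ∫ x : Plane,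
        candidate α φ Γ ξ g a σ x t ω * waveOperator a θ x t =
        stableConst α * ∫ p in cylinder n, limUnder atTop (fun N => ∑ k ∈ Finset.range N,
          Γ k ω ^ (-1 / α) * φ (ξ k ω) ^ (-1 / α) * poissonKernel a σ p.1 (ξ k ω) p.2 * g k ω) *
            positiveWave a θ p := by
      rw [IntegrableOn, restrict_univ_prod] at hint
      rw [← integral_prod_symm _ hint, ← restrict_univ_prod,
        setIntegral_eq_of_subset_of_forall_sdiff_eq_zero hms hcyl
          (fun p hp => by rw [hWout p hp, mul_zero]), ← integral_const_mul]
      refine setIntegral_congr_fun (measurableSet_cylinder n) fun p hp => ?_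
      rw [positiveWave_of_pos a θ (hcyl hp).2, ← mul_assoc]
      rfl
    have e2 : ∫ t in Set.Ioi (0 : ℝ), stableIntegral α φ Γ ξ g (fun x => θ x t * σ x t) ω =
        stableConst α * ∫ t in Set.Ioo (0 : ℝ) n, limUnder atTop (fun N =>
          ∑ k ∈ Finset.range N, Γ k ω ^ (-1 / α) * φ (ξ k ω) ^ (-1 / α) *
            (θ (ξ k ω) (max t 0) * σ (ξ k ω) (max t 0)) * g k ω) * 1 := by
      rw [setIntegral_eq_of_subset_of_forall_sdiff_eq_zero measurableSet_Ioi
          (fun t ht => ht.1) hsrcout, ← integral_const_mul]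
      exact setIntegral_congr_fun measurableSet_Ioo fun t ht => (hcongr t ht).symm
    rw [e1, e2]
    congr 1
    -- Both sides are limits of numerical partial sums, and these agree term by term through the
    -- identity for a single source point.
    refine tendsto_nhds_unique (h1 n).tendsto ((h2 n).tendsto.congr fun N => ?_)
    refine Finset.sum_congr rfl fun k _ => ?_
    have e3 : ∫ t in Set.Ioo (0 : ℝ) n, Γ k ω ^ (-1 / α) * φ (ξ k ω) ^ (-1 / α) *
        (θ (ξ k ω) (max t 0) * σ (ξ k ω) (max t 0)) * g k ω * 1 =
        Γ k ω ^ (-1 / α) * φ (ξ k ω) ^ (-1 / α) * g k ω *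
          ∫ t in Set.Ioi (0 : ℝ), θ (ξ k ω) t * σ (ξ k ω) t := by
      rw [setIntegral_eq_of_subset_of_forall_sdiff_eq_zero (s := Set.Ioo (0 : ℝ) n)
        measurableSet_Ioi (fun t ht => ht.1)
        (fun t ht => by rw [hθout _ t ht, zero_mul]), ← integral_const_mul]
      refine setIntegral_congr_fun measurableSet_Ioo fun t ht => ?_
      simp only [max_eq_left ht.1.le]
      ring
    have e4 : ∫ p in cylinder n, Γ k ω ^ (-1 / α) * φ (ξ k ω) ^ (-1 / α) *
        poissonKernel a σ p.1 (ξ k ω) p.2 * g k ω * positiveWave a θ p =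
        Γ k ω ^ (-1 / α) * φ (ξ k ω) ^ (-1 / α) * g k ω *
          ∫ p in Set.univ ×ˢ Set.Ioi (0 : ℝ),
            poissonKernel a σ p.1 (ξ k ω) p.2 * waveOperator a θ p.1 p.2 := by
      rw [setIntegral_eq_of_subset_of_forall_sdiff_eq_zero hms hcyl
          (fun p hp => by rw [hWout p hp, mul_zero]), ← integral_const_mul]
      refine setIntegral_congr_fun (measurableSet_cylinder n) fun p hp => ?_
      rw [positiveWave_of_pos a θ (hcyl hp).2]
      ring
    rw [e3, e4, integral_poissonKernel_mul_waveOperator ha hS1 hS2 hθ]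

end WeakForm

end

end StableWave

/-! ### The two ranges of α. -/

theorem theorem3 {Ω : Type*} [MeasurableSpace Ω] (P : Measure Ω) [IsProbabilityMeasure P]
    (α : ℝ) (hα_pos : 0 < α) (hα_lt : α < 2)
    (φ : StableWave.Plane → ℝ) (Γ : ℕ → Ω → ℝ) (ξ : ℕ → Ω → StableWave.Plane) (g : ℕ → Ω → ℝ)
    (hM : StableWave.IsLePageSystem P α φ Γ ξ g)
    (a : ℝ) (ha : 0 < a) (σ : StableWave.Plane → ℝ → ℝ)
    (hS1 : ∃ C : ℝ, ∀ x t, 0 ≤ t → |σ x t| ≤ C)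
    (hS2 : ContinuousOn (Function.uncurry σ) (Set.univ ×ˢ Set.Ici (0 : ℝ))) :
    (α < 1 → ∃ Ω₀ : Set Ω, MeasurableSet Ω₀ ∧ P Ω₀ = 1 ∧
      ∀ ω ∈ Ω₀, ∀ θ : StableWave.Plane → ℝ → ℝ, StableWave.IsTestFunction θ →
        StableWave.WeakIdentity α φ Γ ξ g a σ θ ω) ∧
    (1 ≤ α → ∀ θ : StableWave.Plane → ℝ → ℝ, StableWave.IsTestFunction θ →
      ∀ᵐ ω ∂P, StableWave.WeakIdentity α φ Γ ξ g a σ θ ω) := by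
  obtain ⟨C, hC⟩ := id hS1
  obtain ⟨G, hG⟩ : ∃ G : StableWave.Plane → StableWave.Plane × ℝ → ℝ,
      G = fun y p => StableWave.poissonKernel a σ p.1 y p.2 := ⟨_, rfl⟩
  have hGm : Measurable (Function.uncurry G) := by
    rw [hG]
    exact StableWave.measurable_poissonKernel ha hS2
  have hGv : ∀ x y t, StableWave.poissonKernel a σ x y t = G y (x, t) := fun x y t => by rw [hG]
  constructor
  · intro hα1
    have hp : 1 < 1 / α := (one_lt_div hα_pos).2 hα1
    have hw : ∀ᵐ ω ∂P, ∀ R : ℕ, Summable fun k =>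
        Γ k ω ^ (-1 / α) * φ (ξ k ω) ^ (-1 / α) * g k ω *
          (Metric.closedBall 0 (R : ℝ)).indicator (fun _ => (1 : ℝ)) (ξ k ω) := by
      refine ae_all_iff.2 fun R => ?_
      have hfin : ∫⁻ ω, ENNReal.ofReal (|g 0 ω| ^ (1 / (1 / α))) ∂P ≠ ⊤ := by
        rw [one_div_one_div]
        have hi : Integrable (fun ω => |g 0 ω| ^ α) P := by
          -- A non-integrable function has integral 0 by convention, which contradicts the moment 1.
          by_contra h
          exact zero_ne_one ((integral_undef h).symm.trans (hM.moment_gaussian 0))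
        rw [← ofReal_integral_eq_lintegral_ofReal hi
          (Eventually.of_forall fun ω => Real.rpow_nonneg (abs_nonneg _) _)]
        exact ENNReal.ofReal_ne_top
      filter_upwards [hM.ae_summable_weights hα_pos hp (z := fun x => |x|) (by fun_prop)
        abs_nonneg hfin R] with ω hω
      refine (summable_norm_iff.1 ((hω.norm).congr fun k => ?_))
      rw [show -(1 / α) = -1 / α by ring]
      simp only [norm_mul, Real.norm_eq_abs, abs_abs]
      ring
    -- The event depends only on the weights and is fixed before `θ` is introduced.
    obtain ⟨s, hs, hsm, hsw⟩ := hw.exists_measurable_mem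
    refine ⟨s, hsm, (mem_ae_iff_prob_eq_one hsm).1 hs, fun ω hω θ hθ => ?_⟩
    refine StableWave.weakIdentity_of_sumsAgainst ha hS1 hS2 hθ (fun n => ?_) fun n => ?_
    · obtain ⟨B, hB, hBle⟩ := StableWave.lintegral_poissonKernel_le ha hC (n : ℝ)
      obtain ⟨D, hD⟩ := hθ.exists_positiveWave_bound a
      simp_rw [hGv] at hBle ⊢
      exact StableWave.sumsAgainst_of_summable (hsw ω hω)
        (fun y => hGm.comp measurable_prodMk_left) hB hBle (hθ.measurable_positiveWave a) hD
    · obtain ⟨R, B, hB, hBle⟩ := hθ.lintegral_source_pow_le hS1 n 1 one_ne_zero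
      simp_rw [pow_one] at hBle
      exact StableWave.sumsAgainst_of_summable (hsw ω hω)
        (K := fun y t => θ y (max t 0) * σ y (max t 0))
        (fun y => (hθ.continuous_source hS2).measurable.comp measurable_prodMk_left) hB hBle
        measurable_const (C := 1) (by simp)
  · intro hα1 θ hθ
    -- Convergence is only conditional here, and the null event depends on the function integrated
    -- against, hence on `θ`.
    have h1 : ∀ᵐ ω ∂P, ∀ n : ℕ, StableWave.SumsAgainst (volume.restrict (StableWave.cylinder n))
        (fun k p => Γ k ω ^ (-1 / α) * φ (ξ k ω) ^ (-1 / α) *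
          StableWave.poissonKernel a σ p.1 (ξ k ω) p.2 * g k ω) (StableWave.positiveWave a θ) := by
      refine ae_all_iff.2 fun n => ?_
      obtain ⟨B, hB, hBle⟩ := StableWave.lintegral_poissonKernel_sq_le ha hC (n : ℝ)
      obtain ⟨D, hD⟩ := hθ.exists_positiveWave_bound a
      simp_rw [hGv] at hBle ⊢
      refine hM.ae_sumsAgainst hα_pos hα_lt hGm hB hBle (hθ.measurable_positiveWave a) ?_
      refine ne_top_of_le_ne_top (b := ∫⁻ _ in StableWave.cylinder n, ENNReal.ofReal D ^ 2) ?_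
        (lintegral_mono fun p => ?_)
      · rw [setLIntegral_const]
        exact ENNReal.mul_ne_top (by finiteness) (StableWave.volume_cylinder_lt_top n).ne
      · simp only
        rw [Real.enorm_eq_ofReal_abs]
        gcongr
        exact hD p
    have h2 : ∀ᵐ ω ∂P, ∀ n : ℕ, StableWave.SumsAgainst (volume.restrict (Set.Ioo (0 : ℝ) n))
        (fun k t => Γ k ω ^ (-1 / α) * φ (ξ k ω) ^ (-1 / α) *
          (θ (ξ k ω) (max t 0) * σ (ξ k ω) (max t 0)) * g k ω) (fun _ => 1) := by
      refine ae_all_iff.2 fun n => ?_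
      obtain ⟨R, B, hB, hBle⟩ := hθ.lintegral_source_pow_le hS1 n 2 two_ne_zero
      exact hM.ae_sumsAgainst hα_pos hα_lt
        (K := fun y t => θ y (max t 0) * σ y (max t 0)) (hθ.continuous_source hS2).measurable
        hB hBle measurable_const (by simp)
    filter_upwards [h1, h2] with ω hω1 hω2
    exact StableWave.weakIdentity_of_sumsAgainst ha hS1 hS2 hθ hω1 hω2
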